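/- Let $\Omega\subset\mathbb R^n$ be open and bounded. For a function $q$ on $S\subset\Omega$ write $q^-_S=\inf_S q$, $q^+_S=\sup_S q$; for $q>1$ write $q'=q/(q-1)$. Let $p,r,\sigma:\Omega\to\mathbb R$ be continuous, with $p^-_\Omega>1$, $p(x)<n$, $r$ bounded, and $$p(x)\le r(x)\le p^*(x):=\frac{n\,p(x)}{n-p(x)},\qquad \sigma(x)>\frac{p^*(x)}{p^*(x)-r(x)}\quad\text{wherever } r(x)<p^*(x).$$ Let $0<\varepsilon<p^-_\Omega-1$, $\tilde r=r-\varepsilon$, $t>n/p^-_\Omega$, $\mu\ge1$ and let $b,f,g,h\ge 0$ be functions on $\Omega$ with $f\in L^t(\Omega)$, $g\in L^{t\,p'(\cdot)}(\Omega)$, $h\in L^{t\,r'(\cdot)}(\Omega)$. Let $A:\Omega\times\mathbb R\times\mathbb R^n\to\mathbb R^n$ and $B:\Omega\times\mathbb R\times\mathbb R^n\to\mathbb R$ satisfy, for a.e. $x\in\Omega$ and all $s\in\mathbb R$, $\xi\in\mathbb R^n$, $$\begin{aligned}A(x,s,\xi)\cdot\xi&\ge\mu|\xi|^{p(x)}-b(x)|s|^{\tilde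 r(x)}-f(x),\\ |A(x,s,\xi)|&\le\mu|\xi|^{p(x)-1}+b(x)|s|^{r(x)\frac{p(x)-1}{p(x)}}+g(x),\\ |B(x,s,\xi)|&\le\mu|\xi|^{p(x)\left(1-\frac1{\tilde r(x)}\right)}+b(x)|s|^{\tilde r(x)-1}+h(x).\end{aligned}$$ Let $u\in W^{1,p(\cdot)}(\Omega)$ be a weak solution of $-\operatorname{div}A(x,u,\nabla u)=B(x,u,\nabla u)$ in $\Omega$, that is, $A(\cdot,u,\nabla u)$ and $B(\cdot,u,\nabla u)$ are locally integrable in $\Omega$ and $\int_\Omega A(x,u,\nabla u)\cdot\nabla\varphi\,dx=\int_\Omega B(x,u,\nabla u)\,\varphi\,dx$ for all $\varphi\in C_0^\infty(\Omega)$. Let $D\subset\Omega$ be an open set (for instance $D=\Omega$, or a small ball) on which $r^+_D<(p^*)^-_D$ and $b\in L^{s(\cdot)}(D)$, where $$\kappa=\frac{(p^*)^-_D}{(p^*)^-_D-r^+_D},\qquad s(x)=\frac{p(x)(1+\varepsilon)}{p(x)-\varepsilon-1}\,\max\{\sigma(x),\,t\,\kappa\}.$$ Then, for every constant $c>0$,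 $u$ is a local quasiminimizer in $D$ of $$J(u)=\int\left(|\nabla u|^{p(x)}+\mathbb B(x)|u|^{r(x)}+z(x)\right)dx,$$ where $$\mathbb B=c\left(b+b^{\frac{p(\cdot)}{p(\cdot)-1}}+b^{\frac{r(\cdot)}{\tilde r(\cdot)-1}}\right),\qquad z=1+b+f+g^{p'(\cdot)}+h^{r'(\cdot)}+\mathbb B+\mathbb B^{\kappa}.$$ This means: every $y\in D$ has an open neighbourhood $U\subset D$ and a constant $K\ge1$ such that, for every open $\Omega'$ with compact closure contained in $U$, $J_{\Omega'}(u)<\infty$, and $J_{\Omega'}(u)\le K\,J_{\Omega'}(v)$ for all $v\in W^{1,p(\cdot)}_{loc}(U)$ with $u-v\in W^{1,p(\cdot)}_0(\Omega')$. Here $J_{\Omega'}$ denotes the integral over $\Omega'$, and $W^{1,p(\cdot)}_0(\Omega')$ is the closure of $C_0^\infty(\Omega')$ in $W^{1,p(\cdot)}(\Omega')$. -/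

import Mathlib

open MeasureTheory Set
open scoped ContDiff RealInnerProductSpace

noncomputable section

namespace VarExp

/-- Euclidean space `ℝⁿ`. -/
abbrev E (n : ℕ) : Type := EuclideanSpace ℝ (Fin n)

variable {n : ℕ}

/-! ### Variable exponents -/

/-- `p⁻` on `S`; for the continuous exponents on open sets used here, the infimum is the essential
infimum. -/
def lower (p : E n → ℝ) (S : Set (E n)) : ℝ := sInf (p '' S)

/-- `p⁺` on `S`; for the continuous exponents on open sets used here, the supremum is the essential
supremum. -/
def upper (p : E n → ℝ) (S : Set (E n)) : ℝ := sSup (p '' S)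

/-- The conjugate exponent `p'(x) = p(x) / (p(x) - 1)`. -/
def conjExp (p : E n → ℝ) (x : E n) : ℝ := p x / (p x - 1)

/-- The Sobolev conjugate exponent `p*(x) = n p(x) / (n - p(x))` (used where `p(x) < n`). -/
def sobolevExp (p : E n → ℝ) (x : E n) : ℝ := p x * n / (n - p x)

/-! ### Variable exponent Lebesgue and Sobolev spaces -/

/-- The modular `∫_Ω |u(x)|^{p(x)} dx`, with values in `[0, ∞]`. -/
def modular {F : Type*} [NormedAddCommGroup F] (p : E n → ℝ) (Ω : Set (E n)) (u : E n → F) :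
    ENNReal :=
  ∫⁻ x in Ω, ENNReal.ofReal (‖u x‖ ^ p x)

/-- `u ∈ L^{p(·)}(Ω)`: measurable, and the modular of `u / l` is finite for some `l > 0`. -/
def MemVarLp {F : Type*} [NormedAddCommGroup F] [NormedSpace ℝ F] (p : E n → ℝ) (Ω : Set (E n))
    (u : E n → F) : Prop :=
  AEStronglyMeasurable u (volume.restrict Ω) ∧
    ∃ l : ℝ, 0 < l ∧ modular p Ω (fun x => l⁻¹ • u x) < ⊤

/-- The Luxemburg norm `inf {l > 0 : modular (u / l) ≤ 1}`, with values in `[0, ∞]`. -/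
def luxNorm {F : Type*} [NormedAddCommGroup F] [NormedSpace ℝ F] (p : E n → ℝ) (Ω : Set (E n))
    (u : E n → F) : ENNReal :=
  sInf {L : ENNReal | ∃ l : ℝ, 0 < l ∧ L = ENNReal.ofReal l ∧
    modular p Ω (fun x => l⁻¹ • u x) ≤ 1}

/-- `φ ∈ C₀^∞(Ω)`. -/
def IsTestFunction (Ω : Set (E n)) (φ : E n → ℝ) : Prop :=
  ContDiff ℝ ∞ φ ∧ HasCompactSupport φ ∧ tsupport φ ⊆ Ω

/-- `Du` is the distributional gradient of `u` in the open set `Ω`. -/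
def IsWeakGradient (Ω : Set (E n)) (u : E n → ℝ) (Du : E n → E n) : Prop :=
  LocallyIntegrableOn u Ω ∧ LocallyIntegrableOn Du Ω ∧
    ∀ φ : E n → ℝ, IsTestFunction Ω φ →
      ∫ x in Ω, u x • gradient φ x = -∫ x in Ω, φ x • Du x

/-- `u ∈ W^{1,p(·)}(Ω)`, with distributional gradient `Du`. -/
def MemSobolev (p : E n → ℝ) (Ω : Set (E n)) (u : E n → ℝ) (Du : E n → E n) : Prop :=
  IsWeakGradient Ω u Du ∧ MemVarLp p Ω u ∧ MemVarLp p Ω Du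

/-- `V ⋐ Ω`: the closure of `V` is a compact subset of `Ω`. -/
def CompactlyInside (V Ω : Set (E n)) : Prop := IsCompact (closure V) ∧ closure V ⊆ Ω

/-- `u ∈ W^{1,p(·)}_loc(Ω)`, with distributional gradient `Du`. -/
def MemSobolevLoc (p : E n → ℝ) (Ω : Set (E n)) (u : E n → ℝ) (Du : E n → E n) : Prop :=
  IsWeakGradient Ω u Du ∧
    ∀ V : Set (E n), IsOpen V → CompactlyInside V Ω → MemSobolev p V u Du

/-- `w ∈ W₀^{1,p(·)}(Ω)`, with distributional gradient `Dw`: the closure of `C₀^∞(Ω)` in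
`W^{1,p(·)}(Ω)`. -/
def MemSobolevZero (p : E n → ℝ) (Ω : Set (E n)) (w : E n → ℝ) (Dw : E n → E n) : Prop :=
  MemSobolev p Ω w Dw ∧
    ∀ ε : ENNReal, 0 < ε → ∃ φ : E n → ℝ, IsTestFunction Ω φ ∧
      luxNorm p Ω (fun x => φ x - w x) + luxNorm p Ω (fun x => gradient φ x - Dw x) < ε

/-! ### Quasiminimizers -/

/-- The energy `∫_Ω F(x, u, Du) dx ∈ [0, ∞]` of a nonnegative integrand `F`. -/
def energy (F : E n → ℝ → E n → ℝ) (Ω : Set (E n)) (u : E n → ℝ) (Du : E n → E n) : ENNReal :=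
  ∫⁻ x in Ω, ENNReal.ofReal (F x (u x) (Du x))

/-- `u` is a `K`-quasiminimizer in `Ω` of the energy with (nonnegative) integrand `F`: its energy is
finite on every open `Ω' ⋐ Ω`, and is at most `K` times that of every competitor `v` in
`W^{1,p(·)}_loc(Ω)` with `u - v` in `W₀^{1,p(·)}(Ω')`. -/
def IsQuasiminimizer (p : E n → ℝ) (F : E n → ℝ → E n → ℝ) (K : ℝ) (Ω : Set (E n))
    (u : E n → ℝ) (Du : E n → E n) : Prop :=
  MemSobolevLoc p Ω u Du ∧
    ∀ Ω' : Set (E n), IsOpen Ω' → CompactlyInside Ω' Ω →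
      energy F Ω' u Du < ⊤ ∧
      ∀ (v : E n → ℝ) (Dv : E n → E n), MemSobolevLoc p Ω v Dv →
        MemSobolevZero p Ω' (fun x => u x - v x) (fun x => Du x - Dv x) →
        energy F Ω' u Du ≤ ENNReal.ofReal K * energy F Ω' v Dv

/-- `u` is a local quasiminimizer in `Ω`: every point of `Ω` has an open neighbourhood in `Ω` in
which `u` is a `K`-quasiminimizer for some `K ≥ 1`. -/
def IsLocalQuasiminimizer (p : E n → ℝ) (F : E n → ℝ → E n → ℝ) (Ω : Set (E n))
    (u : E n → ℝ) (Du : E n → E n) : Prop :=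
  MemSobolevLoc p Ω u Du ∧
    ∀ y ∈ Ω, ∃ U : Set (E n), IsOpen U ∧ y ∈ U ∧ U ⊆ Ω ∧
      ∃ K : ℝ, 1 ≤ K ∧ IsQuasiminimizer p F K U u Du

/-! ### The equation -/

/-- `u ∈ W^{1,p(·)}(Ω)`, with distributional gradient `Du`, is a weak solution in `Ω` of
`-div A(x, u, ∇u) = B(x, u, ∇u)`. -/
def IsWeakSolution (p : E n → ℝ) (Ω : Set (E n)) (A : E n → ℝ → E n → E n)
    (B : E n → ℝ → E n → ℝ) (u : E n → ℝ) (Du : E n → E n) : Prop :=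
  MemSobolev p Ω u Du ∧
    LocallyIntegrableOn (fun x => A x (u x) (Du x)) Ω ∧
    LocallyIntegrableOn (fun x => B x (u x) (Du x)) Ω ∧
    ∀ φ : E n → ℝ, IsTestFunction Ω φ →
      ∫ x in Ω, ⟪A x (u x) (Du x), gradient φ x⟫ = ∫ x in Ω, B x (u x) (Du x) * φ x

/-- The structural conditions on `A` and `B` in `Ω`, where `q` denotes `r - ε`. -/
def StructureConditions (Ω : Set (E n)) (p r : E n → ℝ) (ε μ : ℝ) (b f g h : E n → ℝ)
    (A : E n → ℝ → E n → E n) (B : E n → ℝ → E n → ℝ) : Prop :=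
  ∀ᵐ x ∂volume.restrict Ω, ∀ (s : ℝ) (ξ : E n),
    let q : ℝ := r x - ε
    μ * ‖ξ‖ ^ p x - b x * |s| ^ q - f x ≤ ⟪A x s ξ, ξ⟫ ∧
    ‖A x s ξ‖ ≤ μ * ‖ξ‖ ^ (p x - 1) + b x * |s| ^ (r x * ((p x - 1) / p x)) + g x ∧
    |B x s ξ| ≤ μ * ‖ξ‖ ^ (p x * (1 - 1 / q)) + b x * |s| ^ (q - 1) + h x

/-- The number `p*₋ / (p*₋ - r₊)`, with the extremal values of the exponents taken over `D`
(used where `r₊ < p*₋`). -/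
def critExp (p r : E n → ℝ) (D : Set (E n)) : ℝ :=
  lower (sobolevExp p) D / (lower (sobolevExp p) D - upper r D)

/-- The integrability exponent
`s(x) = p(x) (1 + ε) / (p(x) - ε - 1) * max {σ(x), t p*₋ / (p*₋ - r₊)}` of the coefficient `b`. -/
def coeffExp (p r σ : E n → ℝ) (ε t : ℝ) (D : Set (E n)) (x : E n) : ℝ :=
  p x * (1 + ε) / (p x - ε - 1) * max (σ x) (t * critExp p r D)

/-- The coefficient `𝔹(x) = c (b + b^{p/(p-1)} + b^{r/(r-ε-1)})`. -/
def bigB (p r : E n → ℝ) (ε c : ℝ) (b : E n → ℝ) (x : E n) : ℝ :=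
  c * (b x + b x ^ (p x / (p x - 1)) + b x ^ (r x / (r x - ε - 1)))

/-- The coefficient `z = 1 + b + f + g^{p'} + h^{r'} + 𝔹 + 𝔹^{p*₋/(p*₋ - r₊)}`. -/
def zCoeff (p r : E n → ℝ) (ε c : ℝ) (b f g h : E n → ℝ) (D : Set (E n)) (x : E n) : ℝ :=
  1 + b x + f x + g x ^ conjExp p x + h x ^ conjExp r x + bigB p r ε c b x
    + bigB p r ε c b x ^ critExp p r D

/-- The integrand `|ξ|^{p(x)} + 𝔹(x) |s|^{r(x)} + z(x)` of the functional `J_D`. -/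
def integrandJ (p r : E n → ℝ) (ε c : ℝ) (b f g h : E n → ℝ) (D : Set (E n))
    (x : E n) (s : ℝ) (ξ : E n) : ℝ :=
  ‖ξ‖ ^ p x + bigB p r ε c b x * |s| ^ r x + zCoeff p r ε c b f g h D x

end VarExp

end

noncomputable section

namespace VarExp

variable {n : ℕ}

/-! ### Young-type inequalities for real powers -/

/-! Let $F$ be the integrand of $J$, $P=(p^*)^-_D$, $R=r^+_D<P$ and $w=u-v$. Coercivity bounds
$|\nabla u|^p$ by $A\cdot\nabla u$; splitting off the comparison terms and applying Young's
inequality to the growth bounds gives, pointwise and for every $\eta>0$, $F(u,\nabla u)\le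
2\,(A\cdot\nabla w-B\,w)+C_\eta F(v,\nabla v)+\eta|w|^P$ (`exists_integrandJ_le`). The coefficients
$\mathbb B$ and $z$ are what Young's inequality produces; in particular $\mathbb
B|w|^R\le\eta|w|^P+C\,\mathbb B^{P/(P-R)}$ explains the last summand of $z$.

The integral of $A\cdot\nabla w-Bw$ vanishes: the growth bounds, in the form of
`exists_abs_pairing_le`, let $C_0^\infty$ test functions be replaced by $W^{1,p(\cdot)}_0$ functions
(`MemSobolevZero.integral_pairing_eq_zero`).

There remains $\eta\int|w|^P$. Let $p_0$ have Sobolev conjugate $P$; then $1<p_0\le p$ on $D$, and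
the Sobolev inequality for zero boundary values gives $\int|w|^P\le C\,(\int 1+|\nabla
w|^p)^{P/p_0}$. Only competitors with $J(v)<J(u)$ matter, so the right side is at most
$C\,J(u)^{P/p_0}$. The excess power is harmless: $J_{\Omega'}(u)^{P/p_0-1}\le J_U(u)^{P/p_0-1}$ is a
constant fixed before $\eta$. A suitable $\eta$ absorbs the term into the left side, with $K$
independent of $\Omega'$ and of $v$ (`exists_isQuasiminimizer`).

The neighbourhood $U$ need not be small; it only has to make $J_U(u)$ finite. This follows from
integrability of $z$ on $D$ (`integrableOn_zCoeff`) and from $u\in L^P(U)$, the local Sobolev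
embedding (`IsWeakGradient.memLp_ball`). -/

lemma mul_le_young {α Y η θ : ℝ} (hα : 0 ≤ α) (hY : 0 ≤ Y) (hη : 0 < η) (hθ : 1 < θ) :
    α * Y ≤ η * α ^ (θ / (θ - 1)) + η ^ (1 - θ) * Y ^ θ := by
  have hθ1 : 0 < θ - 1 := by linarith
  -- At this threshold both terms on the right equal $\alpha Y$; on either side of it one of them
  -- suffices alone.
  rcases le_or_gt Y (η * α ^ (1 / (θ - 1))) with h | h
  · have h1 : α * Y ≤ η * α ^ (θ / (θ - 1)) := by
      rcases hα.eq_or_lt with rfl | hα'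
      · simp only [zero_mul]; positivity
      have : α ^ (θ / (θ - 1)) = α * α ^ (1 / (θ - 1)) := by
        rw [← Real.rpow_one_add' hα (by positivity)]
        congr 1; field_simp; ring
      rw [this]
      nlinarith
    have : 0 ≤ η ^ (1 - θ) * Y ^ θ := by positivity
    linarith
  · have h1 : α ≤ (Y / η) ^ (θ - 1) := by
      have h2 : α ^ (1 / (θ - 1)) ≤ Y / η := by
        rw [le_div_iff₀ hη]; linarith
      calc α = (α ^ (1 / (θ - 1))) ^ (θ - 1) := by
            rw [← Real.rpow_mul hα, one_div, inv_mul_cancel₀ hθ1.ne', Real.rpow_one]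
        _ ≤ _ := Real.rpow_le_rpow (by positivity) h2 hθ1.le
    have hY0 : 0 < Y := lt_of_le_of_lt (by positivity) h
    have h3 : α * Y ≤ η ^ (1 - θ) * Y ^ θ := by
      calc α * Y ≤ (Y / η) ^ (θ - 1) * Y := by gcongr
        _ = η ^ (1 - θ) * Y ^ θ := by
          rw [Real.div_rpow hY hη.le, show (1 - θ) = -(θ - 1) by ring, Real.rpow_neg hη.le,
            show θ = (θ - 1) + 1 by ring, Real.rpow_add_one hY0.ne']
          simp only [add_sub_cancel_right]; field_simp
    have : 0 ≤ η * α ^ (θ / (θ - 1)) := by positivity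
    linarith

/-- The weight no longer depends on $\theta$, which will be a function of the point $x$. -/
lemma mul_le_young_of_le {α Y η θ R : ℝ} (hα : 0 ≤ α) (hY : 0 ≤ Y) (hη : 0 < η) (hη1 : η ≤ 1)
    (hθ : 1 < θ) (hθR : θ ≤ R) :
    α * Y ≤ η * α ^ (θ / (θ - 1)) + η ^ (-R) * Y ^ θ := by
  refine (mul_le_young hα hY hη hθ).trans ?_
  have : η ^ (1 - θ) ≤ η ^ (-R) :=
    Real.rpow_le_rpow_of_exponent_ge hη hη1 (by linarith)
  gcongr

/-- Splitting at $W=\eta$ keeps the additive error as small as desired, which the density argument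
for test functions needs; compare `rpow_le_one_add_rpow`. -/
lemma rpow_le_add_mul_rpow {W η e P : ℝ} (hW : 0 ≤ W) (hη : 0 < η) (hη1 : η ≤ 1) (he : 1 ≤ e)
    (heP : e ≤ P) : W ^ e ≤ η + η ^ (-P) * W ^ P := by
  rcases le_or_gt W η with h | h
  · have h1 : W ^ e ≤ W := by
      rcases hW.eq_or_lt with rfl | hW'
      · rw [Real.zero_rpow (by linarith)]
      · simpa using Real.rpow_le_rpow_of_exponent_ge hW' (h.trans hη1) he
    have : 0 ≤ η ^ (-P) * W ^ P := by positivity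
    linarith
  · have hW0 : 0 < W := hη.trans h
    have h1 : W ^ (e - P) ≤ η ^ (-P) :=
      (Real.rpow_le_rpow_of_nonpos hη h.le (by linarith)).trans
        (Real.rpow_le_rpow_of_exponent_ge hη hη1 (by linarith))
    have h2 : W ^ e = W ^ (e - P) * W ^ P := by
      rw [← Real.rpow_add hW0]; congr 1; ring
    rw [h2]
    have : W ^ (e - P) * W ^ P ≤ η ^ (-P) * W ^ P := by gcongr
    linarith

lemma rpow_le_one_add_rpow {W e R : ℝ} (hW : 0 ≤ W) (he : 0 ≤ e) (heR : e ≤ R) :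
    W ^ e ≤ 1 + W ^ R := by
  rcases le_or_gt W 1 with h | h
  · have : W ^ e ≤ 1 := Real.rpow_le_one hW h he
    have : 0 ≤ W ^ R := by positivity
    linarith
  · have : W ^ e ≤ W ^ R := Real.rpow_le_rpow_of_exponent_le h.le heR
    linarith

/-- This is where the gap $R<P$ is spent: a subcritical power is a small multiple of the critical
one plus a power of the coefficient, with exponent `critExp` when $P=(p^*)^-_D$ and $R=r^+_D$. -/
lemma mul_rpow_le_add {B W η R P : ℝ} (hB : 0 ≤ B) (hW : 0 ≤ W) (hη : 0 < η) (hR : 0 < R)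
    (hRP : R < P) :
    B * W ^ R ≤ η * W ^ P + η ^ (-(R / (P - R))) * B ^ (P / (P - R)) := by
  have hPR : 0 < P - R := by linarith
  rcases le_or_gt B (η * W ^ (P - R)) with h | h
  · have h1 : B * W ^ R ≤ η * W ^ P := by
      have : W ^ P = W ^ (P - R) * W ^ R := by
        rw [← Real.rpow_add' hW (by linarith)]; congr 1; ring
      rw [this, ← mul_assoc]; gcongr
    have : 0 ≤ η ^ (-(R / (P - R))) * B ^ (P / (P - R)) := by positivity
    linarith
  · have h1 : W ^ (P - R) ≤ B / η := by rw [le_div_iff₀ hη]; linarith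
    have hB0 : 0 < B := lt_of_le_of_lt (by positivity) h
    have h2 : W ^ R ≤ (B / η) ^ (R / (P - R)) := by
      calc W ^ R = (W ^ (P - R)) ^ (R / (P - R)) := by
            rw [← Real.rpow_mul hW]; congr 1; field_simp
        _ ≤ _ := Real.rpow_le_rpow (by positivity) h1 (by positivity)
    have h3 : B * W ^ R ≤ η ^ (-(R / (P - R))) * B ^ (P / (P - R)) := by
      calc B * W ^ R ≤ B * (B / η) ^ (R / (P - R)) := by gcongr
        _ = _ := by
          rw [Real.div_rpow hB hη.le, Real.rpow_neg hη.le,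
            show P / (P - R) = R / (P - R) + 1 by field_simp; ring, Real.rpow_add_one hB0.ne']
          field_simp
    have : 0 ≤ η * W ^ P := by positivity
    linarith

lemma add_rpow_le_two_rpow {S T W r R : ℝ} (hS : 0 ≤ S) (hT : 0 ≤ T) (hW : 0 ≤ W)
    (h : S ≤ T + W) (hr : 0 ≤ r) (hrR : r ≤ R) : S ^ r ≤ 2 ^ R * (T ^ r + W ^ r) := by
  have h1 : S ^ r ≤ (2 * max T W) ^ r := by
    apply Real.rpow_le_rpow hS _ hr
    have := le_max_left T W; have := le_max_right T W; linarith
  have h2 : (max T W) ^ r ≤ T ^ r + W ^ r := by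
    have hT' : 0 ≤ T ^ r := by positivity
    have hW' : 0 ≤ W ^ r := by positivity
    rcases max_choice T W with h | h <;> rw [h] <;> linarith
  have h3 : (2 : ℝ) ^ r ≤ 2 ^ R := Real.rpow_le_rpow_of_exponent_le (by norm_num) hrR
  rw [Real.mul_rpow (by norm_num) (le_max_of_le_left hT)] at h1
  refine h1.trans ?_
  gcongr

/-! ### Pointwise estimates -/

section Pointwise

variable {p r b f g h : E n → ℝ} {ε c : ℝ} {D : Set (E n)} {x : E n}

/-- The sign and size conditions that the exponents and coefficients satisfy at almost every
point. -/
structure Admissible (p r : E n → ℝ) (ε R : ℝ) (b f g h : E n → ℝ) (x : E n) : Prop where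
  b_nonneg : 0 ≤ b x
  f_nonneg : 0 ≤ f x
  g_nonneg : 0 ≤ g x
  h_nonneg : 0 ≤ h x
  one_lt : 1 + ε < p x
  p_le_r : p x ≤ r x
  r_le : r x ≤ R

lemma bigB_nonneg (hc : 0 < c) (hb : 0 ≤ b x) : 0 ≤ bigB p r ε c b x := by
  unfold bigB; positivity

lemma b_terms_le_bigB (hc : 0 < c) (hb : 0 ≤ b x) :
    b x ≤ 1 / c * bigB p r ε c b x ∧ b x ^ (p x / (p x - 1)) ≤ 1 / c * bigB p r ε c b x ∧
      b x ^ (r x / (r x - ε - 1)) ≤ 1 / c * bigB p r ε c b x := by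
  have h0 : 1 / c * bigB p r ε c b x =
      b x + b x ^ (p x / (p x - 1)) + b x ^ (r x / (r x - ε - 1)) := by
    unfold bigB; field_simp
  rw [h0]
  have h1 : 0 ≤ b x ^ (p x / (p x - 1)) := by positivity
  have h2 : 0 ≤ b x ^ (r x / (r x - ε - 1)) := by positivity
  refine ⟨?_, ?_, ?_⟩ <;> linarith

lemma le_zCoeff {R : ℝ} (hc : 0 < c) (H : Admissible p r ε R b f g h x) :
    1 + b x + f x + bigB p r ε c b x + bigB p r ε c b x ^ critExp p r D
        ≤ zCoeff p r ε c b f g h D x ∧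
      g x ^ conjExp p x ≤ zCoeff p r ε c b f g h D x ∧
      h x ^ conjExp r x ≤ zCoeff p r ε c b f g h D x := by
  have h0 := bigB_nonneg (p := p) (r := r) (ε := ε) hc H.b_nonneg
  have h1 : 0 ≤ g x ^ conjExp p x := Real.rpow_nonneg H.g_nonneg _
  have h2 : 0 ≤ h x ^ conjExp r x := Real.rpow_nonneg H.h_nonneg _
  have h3 : 0 ≤ bigB p r ε c b x ^ critExp p r D := Real.rpow_nonneg h0 _
  have := H.b_nonneg; have := H.f_nonneg
  unfold zCoeff
  refine ⟨?_, ?_, ?_⟩ <;> linarith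

/-- The parts of the integrand of `J` are nonnegative. -/
lemma integrandJ_parts {R : ℝ} (hc : 0 < c) (H : Admissible p r ε R b f g h x) (s : ℝ) (ξ : E n) :
    0 ≤ ‖ξ‖ ^ p x ∧ 0 ≤ bigB p r ε c b x * |s| ^ r x ∧ 1 ≤ zCoeff p r ε c b f g h D x := by
  have h0 := bigB_nonneg (p := p) (r := r) (ε := ε) hc H.b_nonneg
  have h3 : 0 ≤ bigB p r ε c b x ^ critExp p r D := Real.rpow_nonneg h0 _
  have := H.b_nonneg; have := H.f_nonneg
  refine ⟨by positivity, by positivity, ?_⟩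
  have := (le_zCoeff (D := D) hc H).1
  linarith

/-- Young's inequality with $\theta=p(x)$: the growth exponents of $A$ are such that the conjugate
power turns the three summands into $|\xi|^p$, $b^{p/(p-1)}|s|^r$ and $g^{p'}$, each dominated by
the integrand of $J$. -/
lemma A_bound_mul_le {R μ η Y : ℝ} (hc : 0 < c) (hε : 0 < ε) (hμ : 1 ≤ μ)
    (H : Admissible p r ε R b f g h x) (hη : 0 < η) (hη1 : η ≤ 1) (hY : 0 ≤ Y) (s : ℝ) (ξ : E n) :
    (μ * ‖ξ‖ ^ (p x - 1) + b x * |s| ^ (r x * ((p x - 1) / p x)) + g x) * Y ≤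
      η * (μ + 1 / c + 1) * integrandJ p r ε c b f g h D x s ξ + (μ + 2) * η ^ (-R) * Y ^ p x := by
  have hp := H.one_lt
  have hp1 : 1 < p x := by linarith
  have hp0 : 0 < p x := by linarith
  have hp' : 0 < p x - 1 := by linarith
  have hpR := H.p_le_r.trans H.r_le
  have hb := H.b_nonneg
  have hg := H.g_nonneg
  have e1 := mul_le_young_of_le (α := ‖ξ‖ ^ (p x - 1)) (by positivity) hY hη hη1 hp1 hpR
  rw [← Real.rpow_mul (norm_nonneg _), show (p x - 1) * (p x / (p x - 1)) = p x by field_simp] at e1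
  have e2 := mul_le_young_of_le (α := b x * |s| ^ (r x * ((p x - 1) / p x)))
    (by positivity) hY hη hη1 hp1 hpR
  rw [Real.mul_rpow hb (by positivity), ← Real.rpow_mul (abs_nonneg _),
    show r x * ((p x - 1) / p x) * (p x / (p x - 1)) = r x by field_simp] at e2
  have e3 := mul_le_young_of_le (α := g x) hg hY hη hη1 hp1 hpR
  obtain ⟨k1, k2, k3⟩ := integrandJ_parts (D := D) hc H s ξ
  have k4 := (le_zCoeff (D := D) hc H).2.1
  have k5 : b x ^ (p x / (p x - 1)) * |s| ^ r x ≤ 1 / c * (bigB p r ε c b x * |s| ^ r x) := by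
    rw [← mul_assoc]
    exact mul_le_mul_of_nonneg_right (b_terms_le_bigB hc hb).2.1 (by positivity)
  unfold conjExp at k4
  have hc' : 0 < 1 / c := by positivity
  have key : μ * ‖ξ‖ ^ p x + b x ^ (p x / (p x - 1)) * |s| ^ r x + g x ^ (p x / (p x - 1)) ≤
      (μ + 1 / c + 1) * integrandJ p r ε c b f g h D x s ξ := by
    unfold integrandJ
    nlinarith [mul_nonneg hc'.le k1, mul_nonneg (by linarith : 0 ≤ μ) k2,
      mul_nonneg hc'.le (by linarith : 0 ≤ zCoeff p r ε c b f g h D x),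
      mul_nonneg (by linarith : 0 ≤ μ) (by linarith : 0 ≤ zCoeff p r ε c b f g h D x)]
  have e1' := mul_le_mul_of_nonneg_left e1 (by linarith : 0 ≤ μ)
  have key' := mul_le_mul_of_nonneg_left key hη.le
  linarith

/-- Each summand has its own Young exponent: $r-\varepsilon$ turns the gradient term into $|\xi|^p$,
$r/(1+\varepsilon)$ turns $b|s|^{r-\varepsilon-1}$ into $b^{r/(r-\varepsilon-1)}|s|^r$, and $r$
turns $h$ into $h^{r'}$. All resulting powers of $W$ have exponent between $1$ and $R$. -/
lemma B_bound_mul_le {R μ η W : ℝ} (hc : 0 < c) (hε : 0 < ε) (hμ : 1 ≤ μ)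
    (H : Admissible p r ε R b f g h x) (hη : 0 < η) (hη1 : η ≤ 1) (hW : 0 ≤ W) (s : ℝ) (ξ : E n) :
    (μ * ‖ξ‖ ^ (p x * (1 - 1 / (r x - ε))) + b x * |s| ^ (r x - ε - 1) + h x) * W ≤
      η * (μ + 1 / c + 1) * integrandJ p r ε c b f g h D x s ξ +
        η ^ (-R) * (μ * W ^ (r x - ε) + W ^ (r x / (1 + ε)) + W ^ r x) := by
  have hp := H.one_lt
  have hpr := H.p_le_r
  have hr : 1 + ε < r x := by linarith
  have hr0 : 0 < r x := by linarith
  have hq : 1 < r x - ε := by linarith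
  have hq' : 0 < r x - ε - 1 := by linarith
  have hR := H.r_le
  have hb := H.b_nonneg
  have e1 := mul_le_young_of_le (α := ‖ξ‖ ^ (p x * (1 - 1 / (r x - ε)))) (by positivity) hW hη hη1
    hq (by linarith : r x - ε ≤ R)
  have hq0 : r x - ε ≠ 0 := by linarith
  rw [← Real.rpow_mul (norm_nonneg _),
    show p x * (1 - 1 / (r x - ε)) * ((r x - ε) / (r x - ε - 1)) = p x by field_simp] at e1
  have e2 := mul_le_young_of_le (α := b x * |s| ^ (r x - ε - 1)) (θ := r x / (1 + ε))
    (by positivity) hW hη hη1 (by rw [lt_div_iff₀ (by linarith)]; linarith)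
    ((div_le_self hr0.le (by linarith)).trans hR)
  have hconj : r x / (1 + ε) / (r x / (1 + ε) - 1) = r x / (r x - ε - 1) := by
    have : r x / (1 + ε) - 1 = (r x - ε - 1) / (1 + ε) := by field_simp; ring
    rw [this, div_div_div_cancel_right₀ (by linarith)]
  rw [hconj, Real.mul_rpow hb (by positivity), ← Real.rpow_mul (abs_nonneg _),
    show (r x - ε - 1) * (r x / (r x - ε - 1)) = r x by field_simp] at e2
  have e3 := mul_le_young_of_le H.h_nonneg hW hη hη1 (by linarith : 1 < r x) hR
  obtain ⟨k1, k2, k3⟩ := integrandJ_parts (D := D) hc H s ξ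
  have k4 := (le_zCoeff (D := D) hc H).2.2
  have k5 : b x ^ (r x / (r x - ε - 1)) * |s| ^ r x ≤ 1 / c * (bigB p r ε c b x * |s| ^ r x) := by
    rw [← mul_assoc]
    exact mul_le_mul_of_nonneg_right (b_terms_le_bigB hc hb).2.2 (by positivity)
  unfold conjExp at k4
  have hc' : 0 < 1 / c := by positivity
  have key : μ * ‖ξ‖ ^ p x + b x ^ (r x / (r x - ε - 1)) * |s| ^ r x + h x ^ (r x / (r x - 1)) ≤
      (μ + 1 / c + 1) * integrandJ p r ε c b f g h D x s ξ := by
    unfold integrandJ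
    nlinarith [mul_nonneg hc'.le k1, mul_nonneg (by linarith : 0 ≤ μ) k2,
      mul_nonneg hc'.le (by linarith : 0 ≤ zCoeff p r ε c b f g h D x),
      mul_nonneg (by linarith : 0 ≤ μ) (by linarith : 0 ≤ zCoeff p r ε c b f g h D x)]
  have e1' := mul_le_mul_of_nonneg_left e1 (by linarith : 0 ≤ μ)
  have key' := mul_le_mul_of_nonneg_left key hη.le
  linarith

/-- The pointwise comparison behind the quasiminimizing property. -/
lemma exists_integrandJ_le {R P μ η : ℝ} (hc : 0 < c) (hε : 0 < ε) (hμ : 1 ≤ μ) (hη : 0 < η)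
    (hR : 0 < R) (hRP : R < P) (hκ : critExp p r D = P / (P - R)) :
    ∃ C : ℝ, 0 ≤ C ∧ ∀ x, Admissible p r ε R b f g h x →
      ∀ (s s' : ℝ) (ξ ζ a : E n) (β : ℝ),
        μ * ‖ξ‖ ^ p x - b x * |s| ^ (r x - ε) - f x ≤ ⟪a, ξ⟫ →
        ‖a‖ ≤ μ * ‖ξ‖ ^ (p x - 1) + b x * |s| ^ (r x * ((p x - 1) / p x)) + g x →
        |β| ≤ μ * ‖ξ‖ ^ (p x * (1 - 1 / (r x - ε))) + b x * |s| ^ (r x - ε - 1) + h x →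
        integrandJ p r ε c b f g h D x s ξ ≤ 2 * (⟪a, ξ - ζ⟫ - β * (s - s')) +
          C * integrandJ p r ε c b f g h D x s' ζ + η * |s - s'| ^ P := by
  have hc' : 0 < 1 / c := by positivity
  set M := μ + 1 / c + 1 with hM
  have hM1 : 1 ≤ M := by linarith
  -- The pairings with $A$ and with $B$ each cost a quarter of the energy density, so half of it can
  -- be absorbed.
  set δ := 1 / (4 * M) with hδdef
  have hδ : 0 < δ := by positivity
  have hδ1 : δ ≤ 1 := by rw [hδdef, div_le_one (by positivity)]; linarith
  have hδM : δ * M = 1 / 4 := by rw [hδdef]; field_simp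
  set m := δ ^ (-R) with hm
  have hm0 : 0 < m := by positivity
  set L : ℝ := (1 + 1 / c) * 2 ^ R with hL
  have hL0 : 0 < L := by positivity
  set N : ℝ := m * (μ + 2) with hN
  have hN0 : 0 < N := by positivity
  -- Two terms contribute $\eta/4\cdot W^P$ each; the final absorption doubles their sum to $\eta
  -- W^P$.
  set η₁ := η / 4 with hη₁
  set η₂ := η / (4 * L) with hη₂
  have hη₂' : L * η₂ = η / 4 := by rw [hη₂]; field_simp
  set C₁ := η₁ ^ (-(R / (P - R))) * N ^ (P / (P - R)) with hC₁
  set C₂ := η₂ ^ (-(R / (P - R))) with hC₂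
  have hPR : 0 < P - R := by linarith
  have hC₁0 : 0 ≤ C₁ := by positivity
  have hC₂0 : 0 ≤ C₂ := by positivity
  refine ⟨2 * ((μ + 2) * m + (N + C₁) + L * (2 + C₂) + 3), by positivity, ?_⟩
  intro x H s s' ξ ζ a β h1 h2 h3
  have hp := H.one_lt
  have hpr := H.p_le_r
  have hrR := H.r_le
  have hb := H.b_nonneg
  set F := integrandJ p r ε c b f g h D x s ξ with hF
  set z := zCoeff p r ε c b f g h D x with hz
  set W := |s - s'| with hW
  have hW0 : 0 ≤ W := abs_nonneg _
  have a1 := A_bound_mul_le (D := D) hc hε hμ H hδ hδ1 (norm_nonneg ζ) s ξ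
  have a2 := B_bound_mul_le (D := D) hc hε hμ H hδ hδ1 hW0 s ξ
  rw [← hM, ← hF, hδM] at a1 a2
  have hA : ⟪a, ζ⟫ ≤ 1 / 4 * F + (μ + 2) * m * ‖ζ‖ ^ p x :=
    (real_inner_le_norm a ζ).trans ((mul_le_mul_of_nonneg_right h2 (norm_nonneg _)).trans a1)
  have hB : β * (s - s') ≤ 1 / 4 * F +
      m * (μ * W ^ (r x - ε) + W ^ (r x / (1 + ε)) + W ^ r x) := by
    refine (le_abs_self _).trans ?_
    rw [abs_mul]
    exact (mul_le_mul_of_nonneg_right h3 hW0).trans a2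
  have w1 := rpow_le_one_add_rpow (e := r x - ε) (R := R) hW0 (by linarith) (by linarith)
  have w2 := rpow_le_one_add_rpow (e := r x / (1 + ε)) (R := R) hW0
    (div_nonneg (by linarith) (by linarith))
    ((div_le_self (by linarith) (by linarith)).trans hrR)
  have w3 := rpow_le_one_add_rpow (e := r x) (R := R) hW0 (by linarith) hrR
  have hWs : m * (μ * W ^ (r x - ε) + W ^ (r x / (1 + ε)) + W ^ r x) ≤ N + N * W ^ R := by
    have := mul_le_mul_of_nonneg_left w1 (by linarith : 0 ≤ μ)
    have := mul_le_mul_of_nonneg_left (add_le_add (add_le_add this w2) w3) hm0.le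
    rw [hN]; linarith
  have hNW := mul_rpow_le_add (B := N) (W := W) (η := η₁) hN0.le hW0 (by positivity) hR hRP
  rw [← hC₁] at hNW
  have hBB := bigB_nonneg (p := p) (r := r) (ε := ε) hc hb
  set BB := bigB p r ε c b x with hBBdef
  have hBW := mul_rpow_le_add (B := BB) (W := W) (η := η₂) hBB hW0 (by positivity) hR hRP
  rw [← hκ, ← hC₂] at hBW
  obtain ⟨k1, k2, k3⟩ := integrandJ_parts (D := D) hc H s' ζ
  rw [← hBBdef] at k2
  rw [← hz] at k3
  have k4 := (le_zCoeff (D := D) hc H).1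
  rw [← hBBdef, ← hz] at k4
  have hκ0 : 0 ≤ BB ^ critExp p r D := Real.rpow_nonneg hBB _
  have hf := H.f_nonneg
  -- Coercivity says nothing about the lower order term of the energy, so it is transferred to $s'$
  -- at the cost of a power of $|s-s'|$.
  have hSr : BB * |s| ^ r x ≤ 2 ^ R * (BB * |s'| ^ r x + (z + (η₂ * W ^ P + C₂ * z))) := by
    have t1 := add_rpow_le_two_rpow (S := |s|) (T := |s'|) (W := W) (r := r x) (R := R)
      (abs_nonneg _) (abs_nonneg _) hW0
      (by have := abs_add_le s' (s - s'); rwa [add_sub_cancel] at this) (by linarith) hrR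
    have t2 := mul_le_mul_of_nonneg_left t1 hBB
    have t3 := mul_le_mul_of_nonneg_left w3 hBB
    have t4 : C₂ * BB ^ critExp p r D ≤ C₂ * z := mul_le_mul_of_nonneg_left (by linarith) hC₂0
    have t5 : BB * W ^ r x ≤ z + (η₂ * W ^ P + C₂ * z) := by linarith
    calc BB * |s| ^ r x ≤ 2 ^ R * (BB * |s'| ^ r x + BB * W ^ r x) := by linarith
      _ ≤ _ := by gcongr
  have hbq : b x * |s| ^ (r x - ε) ≤ z + 1 / c * (BB * |s| ^ r x) := by
    have t1 := mul_le_mul_of_nonneg_left (rpow_le_one_add_rpow (e := r x - ε) (R := r x)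
      (abs_nonneg s) (by linarith) (by linarith)) hb
    have t2 := mul_le_mul_of_nonneg_right (b_terms_le_bigB (p := p) (r := r) (ε := ε) hc hb).1
      (by positivity : 0 ≤ |s| ^ r x)
    rw [← hBBdef] at t2
    linarith
  have hXp : ‖ξ‖ ^ p x ≤ μ * ‖ξ‖ ^ p x := le_mul_of_one_le_left (by positivity) hμ
  have hin : ⟪a, ξ⟫ = ⟪a, ξ - ζ⟫ + ⟪a, ζ⟫ := by rw [inner_sub_right]; ring
  have hFd : F = ‖ξ‖ ^ p x + BB * |s| ^ r x + z := rfl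
  have hFd' : integrandJ p r ε c b f g h D x s' ζ = ‖ζ‖ ^ p x + BB * |s'| ^ r x + z := rfl
  have hLS : (1 + 1 / c) * (BB * |s| ^ r x) ≤
      L * (BB * |s'| ^ r x + (z + C₂ * z)) + η / 4 * W ^ P := by
    have := mul_le_mul_of_nonneg_left hSr (by positivity : 0 ≤ 1 + 1 / c)
    rw [← mul_assoc (1 + 1 / c) ((2 : ℝ) ^ R), ← hL] at this
    have e : L * (η₂ * W ^ P) = η / 4 * W ^ P := by rw [← mul_assoc, hη₂']
    linarith
  have total : F ≤ (⟪a, ξ - ζ⟫ - β * (s - s')) + 1 / 2 * F + (μ + 2) * m * ‖ζ‖ ^ p x +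
      (N + C₁) + L * (BB * |s'| ^ r x + (z + C₂ * z)) + η / 2 * W ^ P + 3 * z := by
    rw [hη₁] at hNW
    linarith
  rw [hFd']
  -- The summand $1$ in $z$ lets additive constants count as energy of the competitor.
  have u1 : (N + C₁) ≤ (N + C₁) * z := le_mul_of_one_le_right (by positivity) k3
  have hz0 : 0 ≤ z := by linarith
  have v1 : 0 ≤ (μ + 2) * m * (BB * |s'| ^ r x + z) := by positivity
  have v2 : 0 ≤ (N + C₁) * (‖ζ‖ ^ p x + BB * |s'| ^ r x) := by positivity
  have v3 : 0 ≤ L * ((2 + C₂) * ‖ζ‖ ^ p x + (1 + C₂) * (BB * |s'| ^ r x) + z) := by positivity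
  linarith

/-- The pairings of the terms of the equation with a pair `(w, ζ)` are dominated by the energy
density, with an arbitrarily small factor, and powers of `w` and `ζ`. -/
lemma exists_abs_pairing_le {R P μ η : ℝ} (hc : 0 < c) (hε : 0 < ε) (hμ : 1 ≤ μ) (hη : 0 < η)
    (hRP : R < P) :
    ∃ C : ℝ, 0 ≤ C ∧ ∀ x, Admissible p r ε R b f g h x →
      ∀ (s w : ℝ) (ξ ζ a : E n) (β : ℝ),
        ‖a‖ ≤ μ * ‖ξ‖ ^ (p x - 1) + b x * |s| ^ (r x * ((p x - 1) / p x)) + g x →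
        |β| ≤ μ * ‖ξ‖ ^ (p x * (1 - 1 / (r x - ε))) + b x * |s| ^ (r x - ε - 1) + h x →
        |⟪a, ζ⟫| + |β * w| ≤ η * integrandJ p r ε c b f g h D x s ξ +
          C * (‖ζ‖ ^ p x + |w| ^ P) := by
  have hc' : 0 < 1 / c := by positivity
  set M := μ + 1 / c + 1 with hM
  have hM1 : 1 ≤ M := by linarith
  -- One third of $\eta$ each for the pairing with $a$, the pairing with $\beta$, and the additive
  -- constants left by `rpow_le_add_mul_rpow`; the last are absorbed because $F\ge1$.
  set δ := min 1 (η / (3 * M)) with hδdef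
  have hδ : 0 < δ := by positivity
  have hδ1 : δ ≤ 1 := min_le_left _ _
  have hδM : δ * M ≤ η / 3 := by
    have : δ ≤ η / (3 * M) := min_le_right _ _
    calc δ * M ≤ η / (3 * M) * M := by gcongr
      _ = η / 3 := by field_simp
  set m := δ ^ (-R) with hm
  have hm0 : 0 < m := by positivity
  set N := m * (μ + 2) with hN
  have hN0 : 0 < N := by positivity
  set η₁ := min 1 (η / (3 * N)) with hη₁
  have hη₁0 : 0 < η₁ := by positivity
  have hη₁1 : η₁ ≤ 1 := min_le_left _ _
  have hη₁N : N * η₁ ≤ η / 3 := by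
    have : η₁ ≤ η / (3 * N) := min_le_right _ _
    calc N * η₁ ≤ N * (η / (3 * N)) := by gcongr
      _ = η / 3 := by field_simp
  set C₁ := η₁ ^ (-P) with hC₁
  have hC₁0 : 0 < C₁ := by positivity
  refine ⟨N + N * C₁, by positivity, ?_⟩
  intro x H s w ξ ζ a β h2 h3
  have hp := H.one_lt
  have hpr := H.p_le_r
  have hrR := H.r_le
  set F := integrandJ p r ε c b f g h D x s ξ with hF
  set W := |w| with hW
  have hW0 : 0 ≤ W := abs_nonneg _
  obtain ⟨k1, k2, k3⟩ := integrandJ_parts (D := D) hc H s ξ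
  have hF1 : 1 ≤ F := by rw [hF]; unfold integrandJ; linarith
  have a1 := A_bound_mul_le (D := D) hc hε hμ H hδ hδ1 (norm_nonneg ζ) s ξ
  have a2 := B_bound_mul_le (D := D) hc hε hμ H hδ hδ1 hW0 s ξ
  rw [← hM, ← hF, ← hm] at a1 a2
  have hδF : δ * M * F ≤ η / 3 * F := mul_le_mul_of_nonneg_right hδM (by linarith)
  have hA : |⟪a, ζ⟫| ≤ η / 3 * F + N * ‖ζ‖ ^ p x := by
    have := (abs_real_inner_le_norm a ζ).trans
      ((mul_le_mul_of_nonneg_right h2 (norm_nonneg _)).trans a1)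
    rw [hN]; linarith
  have hB : |β * w| ≤ η / 3 * F +
      m * (μ * W ^ (r x - ε) + W ^ (r x / (1 + ε)) + W ^ r x) := by
    rw [abs_mul]
    exact ((mul_le_mul_of_nonneg_right h3 hW0).trans a2).trans (by linarith)
  have w1 := rpow_le_add_mul_rpow (e := r x - ε) (P := P) hW0 hη₁0 hη₁1 (by linarith)
    (by linarith)
  have w2 := rpow_le_add_mul_rpow (e := r x / (1 + ε)) (P := P) hW0 hη₁0 hη₁1
    (by rw [le_div_iff₀ (by linarith)]; linarith)
    ((div_le_self (by linarith) (by linarith)).trans (by linarith))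
  have w3 := rpow_le_add_mul_rpow (e := r x) (P := P) hW0 hη₁0 hη₁1 (by linarith) (by linarith)
  have hWs : m * (μ * W ^ (r x - ε) + W ^ (r x / (1 + ε)) + W ^ r x) ≤
      N * η₁ + N * C₁ * W ^ P := by
    have := mul_le_mul_of_nonneg_left w1 (by linarith : 0 ≤ μ)
    have := mul_le_mul_of_nonneg_left (add_le_add (add_le_add this w2) w3) hm0.le
    rw [hN]; linarith
  have hηF : η / 3 ≤ η / 3 * F := le_mul_of_one_le_right (by positivity) hF1
  have v1 : 0 ≤ N * C₁ * ‖ζ‖ ^ p x := by positivity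
  have v2 : 0 ≤ N * W ^ P := by positivity
  linarith

end Pointwise

/-! ### The Sobolev inequality for functions with zero boundary values -/

section SobolevZero

open Filter Topology NNReal ENNReal

lemma norm_gradient (φ : E n → ℝ) (x : E n) : ‖gradient φ x‖ = ‖fderiv ℝ φ x‖ := by
  unfold gradient
  exact LinearIsometryEquiv.norm_map _ _

/-- The constant in the Gagliardo-Nirenberg-Sobolev inequality on `ℝⁿ`. -/
def gnsConst (n : ℕ) (p₀ : ℝ≥0) : ℝ≥0 :=
  SNormLESNormFDerivOfEqConst ℝ (volume : Measure (E n)) p₀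

lemma eLpNorm_le_eLpNorm_gradient {φ : E n → ℝ} {p₀ P : ℝ≥0} (hp₀ : 1 ≤ p₀) (hn : 0 < n)
    (hP : (P : ℝ)⁻¹ = (p₀ : ℝ)⁻¹ - (n : ℝ)⁻¹) (hφ : ContDiff ℝ 1 φ) (hφc : HasCompactSupport φ) :
    eLpNorm φ P volume ≤ gnsConst n p₀ * eLpNorm (gradient φ) p₀ volume := by
  have h := eLpNorm_le_eLpNorm_fderiv_of_eq (volume : Measure (E n)) hφ hφc hp₀
    (p' := P) (by simpa using hn) (by simpa using hP)
  have h2 : eLpNorm (gradient φ) p₀ (volume : Measure (E n)) = eLpNorm (fderiv ℝ φ) p₀ volume :=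
    eLpNorm_congr_norm_ae (Eventually.of_forall (norm_gradient φ))
  rw [h2]
  exact h

lemma gradient_eq_zero_of_notMem_tsupport {φ : E n → ℝ} {x : E n} (hx : x ∉ tsupport φ) :
    gradient φ x = 0 := by
  have h : fderiv ℝ φ x = 0 := by
    by_contra h
    exact hx (support_fderiv_subset ℝ h)
  rw [← norm_eq_zero, norm_gradient, h, norm_zero]

lemma gradient_sub' {φ ψ : E n → ℝ} (hφ : ContDiff ℝ ∞ φ) (hψ : ContDiff ℝ ∞ ψ) (x : E n) :
    gradient (fun y => φ y - ψ y) x = gradient φ x - gradient ψ x := by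
  have h1 := (hφ.differentiable (by simp)) x
  have h2 := (hψ.differentiable (by simp)) x
  unfold gradient
  rw [fderiv_fun_sub h1 h2, map_sub]

lemma IsTestFunction.sub {S : Set (E n)} {φ ψ : E n → ℝ} (hφ : IsTestFunction S φ)
    (hψ : IsTestFunction S ψ) : IsTestFunction S (fun x => φ x - ψ x) :=
  ⟨hφ.1.sub hψ.1, hφ.2.1.sub hψ.2.1,
    (tsupport_sub φ ψ).trans (union_subset hφ.2.2 hψ.2.2)⟩

lemma IsTestFunction.mono {S T : Set (E n)} {φ : E n → ℝ} (hφ : IsTestFunction S φ)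
    (h : S ⊆ T) : IsTestFunction T φ :=
  ⟨hφ.1, hφ.2.1, hφ.2.2.trans h⟩

lemma IsTestFunction.continuous_gradient {S : Set (E n)} {φ : E n → ℝ} (hφ : IsTestFunction S φ) :
    Continuous (gradient φ) := by
  unfold gradient
  exact (LinearIsometryEquiv.continuous _).comp (hφ.1.continuous_fderiv (by simp))

lemma IsTestFunction.gradient_eq_zero {S : Set (E n)} {φ : E n → ℝ} (hφ : IsTestFunction S φ)
    {x : E n} (hx : x ∉ S) : gradient φ x = 0 :=
  gradient_eq_zero_of_notMem_tsupport fun h => hx (hφ.2.2 h)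

lemma IsTestFunction.eq_zero {S : Set (E n)} {φ : E n → ℝ} (hφ : IsTestFunction S φ)
    {x : E n} (hx : x ∉ S) : φ x = 0 :=
  image_eq_zero_of_notMem_tsupport fun h => hx (hφ.2.2 h)

/-- Convergence in $L^{p_0}$ yields an a.e. convergent subsequence; Fatou's lemma then carries the
Gagliardo-Nirenberg-Sobolev inequality to the limit. -/
lemma eLpNorm_le_of_tendsto_test {S : Set (E n)} (hS : MeasurableSet S) {p₀ P : ℝ≥0}
    (hp₀ : 1 ≤ p₀) (hn : 0 < n) (hP : (P : ℝ)⁻¹ = (p₀ : ℝ)⁻¹ - (n : ℝ)⁻¹)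
    {w : E n → ℝ} {X : E n → E n} {φ : ℕ → E n → ℝ} (hφ : ∀ k, IsTestFunction S (φ k))
    (hw : AEStronglyMeasurable w (volume.restrict S))
    (hX : AEStronglyMeasurable X (volume.restrict S))
    (hlim : Tendsto (fun k => eLpNorm (fun x => φ k x - w x) p₀ (volume.restrict S)) atTop (𝓝 0))
    (hlim' : Tendsto (fun k => eLpNorm (fun x => gradient (φ k) x - X x) p₀ (volume.restrict S))
      atTop (𝓝 0)) :
    eLpNorm w P (volume.restrict S) ≤ gnsConst n p₀ * eLpNorm X p₀ (volume.restrict S) := by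
  have hmeas : ∀ k, AEStronglyMeasurable (φ k) (volume.restrict S) := fun k =>
    (hφ k).1.continuous.aestronglyMeasurable
  have hp₀0 : (p₀ : ℝ≥0∞) ≠ 0 := by
    have : p₀ ≠ 0 := by intro h; simp [h] at hp₀
    simpa using this
  have hmeasure := tendstoInMeasure_of_tendsto_eLpNorm (μ := volume.restrict S) hp₀0 hmeas hw hlim
  obtain ⟨ns, hns, hae⟩ := hmeasure.exists_seq_tendsto_ae
  refine (Lp.eLpNorm_lim_le_liminf_eLpNorm (fun k => hmeas (ns k)) w hae).trans ?_
  have hbound : ∀ k, eLpNorm (φ (ns k)) P (volume.restrict S) ≤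
      gnsConst n p₀ * (eLpNorm X p₀ (volume.restrict S) +
        eLpNorm (fun x => gradient (φ (ns k)) x - X x) p₀ (volume.restrict S)) := by
    intro k
    refine (eLpNorm_mono_measure _ Measure.restrict_le_self).trans ?_
    refine (eLpNorm_le_eLpNorm_gradient hp₀ hn hP ((hφ (ns k)).1.of_le (by simp))
      (hφ (ns k)).2.1).trans ?_
    gcongr
    have h1 : eLpNorm (gradient (φ (ns k))) p₀ volume =
        eLpNorm (gradient (φ (ns k))) p₀ (volume.restrict S) := by
      rw [← eLpNorm_indicator_eq_eLpNorm_restrict hS]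
      congr 1
      ext1 x
      by_cases hx : x ∈ S
      · rw [indicator_of_mem hx]
      · rw [indicator_of_notMem hx, (hφ (ns k)).gradient_eq_zero hx]
    rw [h1]
    have h2 : gradient (φ (ns k)) = X + fun x => gradient (φ (ns k)) x - X x := by
      ext1 x; simp
    calc eLpNorm (gradient (φ (ns k))) p₀ (volume.restrict S)
        = eLpNorm (X + fun x => gradient (φ (ns k)) x - X x) p₀ (volume.restrict S) := by
          rw [← h2]
      _ ≤ _ := eLpNorm_add_le hX
          ((hφ (ns k)).continuous_gradient.aestronglyMeasurable.sub hX) (by exact_mod_cast hp₀)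
  have hT : Tendsto (fun k => (gnsConst n p₀ : ℝ≥0∞) * (eLpNorm X p₀ (volume.restrict S) +
        eLpNorm (fun x => gradient (φ (ns k)) x - X x) p₀ (volume.restrict S))) atTop
      (𝓝 (gnsConst n p₀ * (eLpNorm X p₀ (volume.restrict S) + 0))) :=
    ENNReal.Tendsto.const_mul (tendsto_const_nhds.add (hlim'.comp hns.tendsto_atTop))
      (Or.inr ENNReal.coe_ne_top)
  rw [add_zero] at hT
  rw [← hT.liminf_eq]
  exact liminf_le_liminf (Eventually.of_forall hbound)

/-- Membership in $L^{p(\cdot)}$ only controls a rescaled function $v/l$, so the scale $l$ is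
factored out before the exponents are compared. -/
lemma rpow_le_of_modular {F : Type*} [NormedAddCommGroup F] [NormedSpace ℝ F] {v : F} {l q p₀ : ℝ}
    (hl : 0 < l) (hp₀ : 0 < p₀) (hpq : p₀ ≤ q) :
    ‖v‖ ^ p₀ ≤ l ^ p₀ * (1 + ‖l⁻¹ • v‖ ^ q) := by
  have h1 : ‖v‖ = l * ‖l⁻¹ • v‖ := by
    rw [norm_smul, norm_inv, Real.norm_of_nonneg hl.le]; field_simp
  rw [h1, Real.mul_rpow hl.le (norm_nonneg _)]
  gcongr
  rcases le_or_gt ‖l⁻¹ • v‖ 1 with h | h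
  · have := Real.rpow_le_one (norm_nonneg _) h hp₀.le
    have : 0 ≤ ‖l⁻¹ • v‖ ^ q := by positivity
    linarith
  · have := Real.rpow_le_rpow_of_exponent_le h.le hpq
    linarith

lemma lintegral_rpow_le_of_modular {F : Type*} [NormedAddCommGroup F] [NormedSpace ℝ F]
    {p : E n → ℝ} {S : Set (E n)} (hS : MeasurableSet S) {v : E n → F} {l p₀ : ℝ}
    (hl : 0 < l) (hp₀ : 0 < p₀) (hp : ∀ x ∈ S, p₀ ≤ p x) :
    ∫⁻ x in S, ENNReal.ofReal (‖v x‖ ^ p₀) ≤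
      ENNReal.ofReal (l ^ p₀) * (volume S + modular p S (fun x => l⁻¹ • v x)) := by
  unfold modular
  calc ∫⁻ x in S, ENNReal.ofReal (‖v x‖ ^ p₀)
      ≤ ∫⁻ x in S, ENNReal.ofReal (l ^ p₀) * (1 + ENNReal.ofReal (‖l⁻¹ • v x‖ ^ p x)) := by
        refine setLIntegral_mono' hS fun x hx => ?_
        rw [← ENNReal.ofReal_one, ← ENNReal.ofReal_add zero_le_one (by positivity),
          ← ENNReal.ofReal_mul (by positivity)]
        exact ENNReal.ofReal_le_ofReal (rpow_le_of_modular hl hp₀ (hp x hx))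
    _ = _ := by
        rw [lintegral_const_mul' _ _ ENNReal.ofReal_ne_top, lintegral_add_left measurable_const]
        simp

lemma eLpNorm_eq_lintegral_ofReal {F : Type*} [NormedAddCommGroup F] {μ : Measure (E n)}
    {v : E n → F} {p₀ : ℝ≥0} (hp₀ : p₀ ≠ 0) :
    eLpNorm v p₀ μ = (∫⁻ x, ENNReal.ofReal (‖v x‖ ^ (p₀ : ℝ)) ∂μ) ^ (1 / (p₀ : ℝ)) := by
  rw [eLpNorm_nnreal_eq_lintegral hp₀]
  congr 1
  refine lintegral_congr fun x => ?_
  rw [← ENNReal.ofReal_rpow_of_nonneg (norm_nonneg _) p₀.coe_nonneg, ofReal_norm]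

/-- Smallness in the Luxemburg norm controls the modular and the norm in `L^{p₀}`, `p₀ ≤ p`. -/
lemma modular_le_of_luxNorm_lt {F : Type*} [NormedAddCommGroup F] [NormedSpace ℝ F]
    {p : E n → ℝ} {S : Set (E n)} (hS : MeasurableSet S) {v : E n → F} {l₀ : ℝ} {p₀ : ℝ≥0}
    (hl₀1 : l₀ ≤ 1) (hp₀ : 1 ≤ p₀) (hp : ∀ x ∈ S, p₀ ≤ p x)
    (h : luxNorm p S v < ENNReal.ofReal l₀) :
    modular p S v ≤ ENNReal.ofReal l₀ ∧
      eLpNorm v p₀ (volume.restrict S) ≤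
        ENNReal.ofReal l₀ * (volume S + 1) ^ (1 / (p₀ : ℝ)) := by
  unfold luxNorm at h
  obtain ⟨L, ⟨l, hl, rfl, hmod⟩, hL⟩ := sInf_lt_iff.1 h
  have hll₀ : l < l₀ := by
    by_contra hcon
    exact absurd hL (not_lt.2 (ENNReal.ofReal_le_ofReal (not_lt.1 hcon)))
  have hp₀' : (1 : ℝ) ≤ p₀ := by exact_mod_cast hp₀
  have hp₀0 : p₀ ≠ 0 := by rintro rfl; simp at hp₀
  constructor
  · calc modular p S v ≤ ENNReal.ofReal l * modular p S (fun x => l⁻¹ • v x) := by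
          unfold modular
          rw [← lintegral_const_mul' _ _ ENNReal.ofReal_ne_top]
          refine setLIntegral_mono' hS fun x hx => ?_
          rw [← ENNReal.ofReal_mul hl.le]
          refine ENNReal.ofReal_le_ofReal ?_
          have h1 : ‖v x‖ = l * ‖l⁻¹ • v x‖ := by
            rw [norm_smul, norm_inv, Real.norm_of_nonneg hl.le]; field_simp
          rw [h1, Real.mul_rpow hl.le (norm_nonneg _)]
          refine mul_le_mul_of_nonneg_right ?_ (by positivity)
          -- Since $l\le1$ and the exponent is at least $1$, the factor $l^{p(x)}$ is at most $l$.
          simpa using Real.rpow_le_rpow_of_exponent_ge hl (hll₀.le.trans hl₀1)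
            (hp₀'.trans (hp x hx))
      _ ≤ ENNReal.ofReal l * 1 := by gcongr
      _ ≤ ENNReal.ofReal l₀ := by rw [mul_one]; exact ENNReal.ofReal_le_ofReal hll₀.le
  · rw [eLpNorm_eq_lintegral_ofReal hp₀0]
    have h1 := lintegral_rpow_le_of_modular hS (v := v) hl (by linarith : (0 : ℝ) < p₀) hp
    calc _ ≤ (ENNReal.ofReal (l ^ (p₀ : ℝ)) * (volume S + 1)) ^ (1 / (p₀ : ℝ)) := by
          refine ENNReal.rpow_le_rpow (h1.trans ?_) (by positivity)
          gcongr
      _ = ENNReal.ofReal l * (volume S + 1) ^ (1 / (p₀ : ℝ)) := by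
          rw [ENNReal.mul_rpow_of_nonneg _ _ (by positivity),
            ENNReal.ofReal_rpow_of_nonneg (by positivity) (by positivity), ← Real.rpow_mul hl.le,
            mul_one_div_cancel (by positivity), Real.rpow_one]
      _ ≤ _ := by gcongr

/-- The second assertion upgrades the approximation: the Luxemburg norm gives closeness of the
functions only at the level of $p$, while the equation has to be tested with closeness in $L^P$. -/
lemma MemSobolevZero.sobolev {p : E n → ℝ} {S : Set (E n)} (hS : MeasurableSet S)
    (hSfin : volume S ≠ ⊤) {p₀ P : ℝ≥0}
    (hp₀ : 1 ≤ p₀) (hn : 0 < n) (hP : (P : ℝ)⁻¹ = (p₀ : ℝ)⁻¹ - (n : ℝ)⁻¹)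
    (hp : ∀ x ∈ S, p₀ ≤ p x) {w : E n → ℝ} {X : E n → E n} (hw : MemSobolevZero p S w X) :
    eLpNorm w P (volume.restrict S) ≤ gnsConst n p₀ * eLpNorm X p₀ (volume.restrict S) ∧
      ∀ δ : ℝ, 0 < δ → ∃ φ, IsTestFunction S φ ∧
        modular p S (fun x => gradient φ x - X x) ≤ ENNReal.ofReal δ ∧
        eLpNorm (fun x => φ x - w x) P (volume.restrict S) ≤ ENNReal.ofReal δ := by
  have hwm := hw.1.2.1.1
  have hXm := hw.1.2.2.1
  set V : ℝ≥0∞ := (volume S + 1) ^ (1 / (p₀ : ℝ)) with hV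
  have hVtop : V ≠ ⊤ := ENNReal.rpow_ne_top_of_nonneg (by positivity) (by finiteness)
  have key : ∀ k : ℕ, ∃ φ, IsTestFunction S φ ∧
      modular p S (fun x => gradient φ x - X x) ≤ ENNReal.ofReal (1 / (k + 1)) ∧
      eLpNorm (fun x => φ x - w x) p₀ (volume.restrict S) ≤ ENNReal.ofReal (1 / (k + 1)) * V ∧
      eLpNorm (fun x => gradient φ x - X x) p₀ (volume.restrict S) ≤
        ENNReal.ofReal (1 / (k + 1)) * V := by
    intro k
    obtain ⟨φ, hφ, hlt⟩ := hw.2 (ENNReal.ofReal (1 / (k + 1)))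
      (ENNReal.ofReal_pos.2 (by positivity))
    have hk : (1 : ℝ) / (k + 1) ≤ 1 := by
      rw [div_le_one (by positivity)]; linarith [k.cast_nonneg (α := ℝ)]
    have h1 := modular_le_of_luxNorm_lt hS hk hp₀ hp (lt_of_le_of_lt le_self_add hlt)
    have h2 := modular_le_of_luxNorm_lt hS hk hp₀ hp (lt_of_le_of_lt le_add_self hlt)
    exact ⟨φ, hφ, h2.1, h1.2, h2.2⟩
  choose φ hφ h1 h2 h3 using key
  have hlim0 : Tendsto (fun k : ℕ => ENNReal.ofReal (1 / ((k : ℝ) + 1))) atTop (𝓝 0) := by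
    have := ENNReal.tendsto_ofReal (tendsto_one_div_add_atTop_nhds_zero_nat (𝕜 := ℝ))
    simpa using this
  have hlimV : Tendsto (fun k : ℕ => ENNReal.ofReal (1 / ((k : ℝ) + 1)) * V) atTop (𝓝 0) := by
    simpa using ENNReal.Tendsto.mul_const hlim0 (Or.inr hVtop)
  have l1 := tendsto_of_tendsto_of_tendsto_of_le_of_le tendsto_const_nhds hlimV
    (fun _ => zero_le) h2
  have l2 := tendsto_of_tendsto_of_tendsto_of_le_of_le tendsto_const_nhds hlimV
    (fun _ => zero_le) h3
  refine ⟨eLpNorm_le_of_tendsto_test hS hp₀ hn hP hφ hwm hXm l1 l2, ?_⟩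
  intro δ hδ
  -- The Sobolev inequality for $\varphi_k-w$ itself, approximated by the test functions
  -- $\varphi_k-\varphi_j$ as $j\to\infty$.
  have happrox : ∀ k, eLpNorm (fun x => φ k x - w x) P (volume.restrict S) ≤
      gnsConst n p₀ * eLpNorm (fun x => gradient (φ k) x - X x) p₀ (volume.restrict S) := by
    intro k
    refine eLpNorm_le_of_tendsto_test (φ := fun j x => φ k x - φ j x) hS hp₀ hn hP
      (fun j => (hφ k).sub (hφ j)) ((hφ k).1.continuous.aestronglyMeasurable.sub hwm)
      ((hφ k).continuous_gradient.aestronglyMeasurable.sub hXm) ?_ ?_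
    · refine l1.congr fun j => ?_
      rw [← eLpNorm_neg]
      congr 1
      ext1 x
      simp
    · refine l2.congr fun j => ?_
      rw [← eLpNorm_neg]
      congr 1
      ext1 x
      rw [gradient_sub' (hφ k).1 (hφ j).1]
      simp
  have l3 : Tendsto (fun k => (gnsConst n p₀ : ℝ≥0∞) *
      eLpNorm (fun x => gradient (φ k) x - X x) p₀ (volume.restrict S)) atTop (𝓝 0) := by
    simpa using ENNReal.Tendsto.const_mul l2 (Or.inr ENNReal.coe_ne_top)
  have l4 := tendsto_of_tendsto_of_tendsto_of_le_of_le tendsto_const_nhds l3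
    (fun _ => zero_le) happrox
  have l5 := tendsto_of_tendsto_of_tendsto_of_le_of_le tendsto_const_nhds hlim0
    (fun _ => zero_le) h1
  have hδ' : (0 : ℝ≥0∞) < ENNReal.ofReal δ := ENNReal.ofReal_pos.2 hδ
  obtain ⟨k, hk1, hk2⟩ := ((l5.eventually (gt_mem_nhds hδ')).and
    (l4.eventually (gt_mem_nhds hδ'))).exists
  exact ⟨φ k, hφ k, hk1.le, hk2.le⟩

end SobolevZero

/-! ### The local Sobolev inequality -/

section SobolevLocal

open Filter Topology NNReal ENNReal ContinuousLinearMap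

/-- Jensen's inequality for the probability measure $|k(x-t)|\,dt$, followed by Tonelli's theorem.
-/
lemma eLpNorm_convolution_le {F : Type*} [NormedAddCommGroup F] [NormedSpace ℝ F]
    {k : E n → ℝ} (hk : Continuous k) (hk1 : ∫⁻ x, ‖k x‖ₑ = 1)
    {X : E n → F} (hX : AEStronglyMeasurable X volume) {p₀ : ℝ≥0} (hp₀ : 1 ≤ p₀) :
    eLpNorm (fun x => ∫ t, k (x - t) • X t) p₀ volume ≤ eLpNorm X p₀ volume := by
  have hp₀0 : p₀ ≠ 0 := by rintro rfl; simp at hp₀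
  have hp₀' : (0 : ℝ) < p₀ := by positivity
  have hkm : ∀ x : E n, Measurable fun t => ‖k (x - t)‖ₑ := fun x =>
    (hk.comp (continuous_const.sub continuous_id)).measurable.enorm
  have jensen : ∀ x, ‖∫ t, k (x - t) • X t‖ₑ ^ (p₀ : ℝ) ≤
      ∫⁻ t, ‖k (x - t)‖ₑ * ‖X t‖ₑ ^ (p₀ : ℝ) := by
    intro x
    set ν := (volume : Measure (E n)).withDensity (fun t => ‖k (x - t)‖ₑ) with hν
    have : IsProbabilityMeasure ν := by
      constructor
      rw [hν, withDensity_apply _ MeasurableSet.univ, Measure.restrict_univ,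
        lintegral_sub_left_eq_self (fun t => ‖k t‖ₑ) x, hk1]
    have hXν : AEStronglyMeasurable X ν := hX.mono_ac (withDensity_absolutelyContinuous _ _)
    have h1 := eLpNorm_le_eLpNorm_of_exponent_le (μ := ν) (p := 1) (q := p₀)
      (by exact_mod_cast hp₀) hXν
    rw [eLpNorm_one_eq_lintegral_enorm, eLpNorm_nnreal_eq_lintegral hp₀0,
      lintegral_withDensity_eq_lintegral_mul₀ (hkm x).aemeasurable hX.enorm,
      lintegral_withDensity_eq_lintegral_mul₀ (hkm x).aemeasurable (hX.enorm.pow_const _)] at h1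
    have h2 : ‖∫ t, k (x - t) • X t‖ₑ ≤ ∫⁻ t, ‖k (x - t)‖ₑ * ‖X t‖ₑ := by
      refine (enorm_integral_le_lintegral_enorm _).trans (le_of_eq ?_)
      exact lintegral_congr fun t => enorm_smul _ _
    calc ‖∫ t, k (x - t) • X t‖ₑ ^ (p₀ : ℝ)
        ≤ ((∫⁻ t, ‖k (x - t)‖ₑ * ‖X t‖ₑ ^ (p₀ : ℝ)) ^ (1 / (p₀ : ℝ))) ^ (p₀ : ℝ) :=
          ENNReal.rpow_le_rpow (h2.trans h1) hp₀'.le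
      _ = _ := by rw [← ENNReal.rpow_mul, one_div_mul_cancel hp₀'.ne', ENNReal.rpow_one]
  rw [eLpNorm_nnreal_eq_lintegral hp₀0, eLpNorm_nnreal_eq_lintegral hp₀0]
  refine ENNReal.rpow_le_rpow ?_ (by positivity)
  calc ∫⁻ x, ‖∫ t, k (x - t) • X t‖ₑ ^ (p₀ : ℝ)
      ≤ ∫⁻ x, ∫⁻ t, ‖k (x - t)‖ₑ * ‖X t‖ₑ ^ (p₀ : ℝ) := lintegral_mono jensen
    _ = ∫⁻ t, ∫⁻ x, ‖k (x - t)‖ₑ * ‖X t‖ₑ ^ (p₀ : ℝ) := by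
        refine lintegral_lintegral_swap ?_
        refine AEMeasurable.mul ?_ ?_
        · exact ((hk.comp (continuous_fst.sub continuous_snd)).measurable.enorm).aemeasurable
        · exact ((hX.enorm.pow_const _).comp_quasiMeasurePreserving
            Measure.quasiMeasurePreserving_snd)
    _ = ∫⁻ t, ‖X t‖ₑ ^ (p₀ : ℝ) := by
        refine lintegral_congr fun t => ?_
        have hm : Measurable fun x => ‖k (x - t)‖ₑ :=
          (hk.comp (continuous_id.sub continuous_const)).measurable.enorm
        rw [lintegral_mul_const'' _ hm.aemeasurable,
          lintegral_sub_right_eq_self (fun x => ‖k x‖ₑ) t, hk1, one_mul]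

/-- The gradient of a mollification is the mollification of the weak gradient. -/
lemma norm_gradient_convolution {k w : E n → ℝ} {X : E n → E n} (hk : ContDiff ℝ ∞ k)
    (hkc : HasCompactSupport k) (hw : LocallyIntegrable w)
    (hweak : ∀ ψ : E n → ℝ, IsTestFunction univ ψ → ∫ x, w x • gradient ψ x = -∫ x, ψ x • X x)
    (x : E n) :
    ‖gradient (fun x => ∫ t, k (x - t) • w t) x‖ = ‖∫ t, k (x - t) • X t‖ := by
  have hconv : (fun x => ∫ t, k (x - t) • w t) = convolution k w (lsmul ℝ ℝ) volume := by
    ext1 x; exact convolution_lsmul_swap.symm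
  have hfd := hkc.hasFDerivAt_convolution_left (lsmul ℝ ℝ) (hk.of_le (by simp)) hw x
  rw [← hconv] at hfd
  have hψ : IsTestFunction univ fun t => k (x - t) :=
    ⟨hk.comp (contDiff_const.sub contDiff_id),
      hkc.comp_homeomorph (Homeomorph.subLeft x), subset_univ _⟩
  -- The reflection $t\mapsto x-t$ produces a sign that cancels the one in the definition of the
  -- weak gradient.
  have hfdk : ∀ t : E n, fderiv ℝ (fun t => k (x - t)) t = -fderiv ℝ k (x - t) := by
    intro t
    have h1 := ((hk.differentiable (by simp)) (x - t)).hasFDerivAt.comp t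
      ((hasFDerivAt_id t).const_sub x)
    rw [comp_neg, comp_id] at h1
    exact h1.fderiv
  have hw' := hweak _ hψ
  have hgi : Integrable fun t => w t • gradient (fun t => k (x - t)) t :=
    hw.integrable_smul_right_of_hasCompactSupport hψ.continuous_gradient
      (HasCompactSupport.intro hψ.2.1 fun y hy => gradient_eq_zero_of_notMem_tsupport hy)
  have hexists : ConvolutionExistsAt (fderiv ℝ k) w x ((lsmul ℝ ℝ).precompL (E n)) volume :=
    (hkc.fderiv (𝕜 := ℝ)).convolutionExists_left _ (hk.continuous_fderiv (by simp)) hw x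
  have hint : Integrable fun t => (lsmul ℝ ℝ).precompL (E n) (fderiv ℝ k (x - t)) (w t) :=
    hexists.integrable_swap
  have key : (convolution (fderiv ℝ k) w ((lsmul ℝ ℝ).precompL (E n)) volume) x =
      innerSL ℝ (∫ t, k (x - t) • X t) := by
    rw [show ∫ t, k (x - t) • X t = -∫ t, w t • gradient (fun t => k (x - t)) t by
      rw [hw', neg_neg]]
    ext e
    rw [convolution_eq_swap, ContinuousLinearMap.integral_apply hint, innerSL_apply_apply,
      inner_neg_left, real_inner_comm, ← integral_inner hgi, ← integral_neg]
    refine integral_congr_ae (Eventually.of_forall fun t => ?_)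
    have : ⟪e, gradient (fun t => k (x - t)) t⟫ = -fderiv ℝ k (x - t) e := by
      rw [real_inner_comm]
      unfold gradient
      rw [InnerProductSpace.toDual_symm_apply, hfdk]; rfl
    simp only [inner_smul_right, this]
    simp [ContinuousLinearMap.precompL_apply, mul_comm]
  rw [norm_gradient, hfd.fderiv, key, innerSL_apply_norm]

/-- Mollifications are smooth with compact support and have gradients no larger in $L^{p_0}$ than
$X$; they converge a.e., so Fatou's lemma applies. -/
lemma eLpNorm_le_of_weakGradient_univ {p₀ P : ℝ≥0} (hp₀ : 1 ≤ p₀) (hn : 0 < n)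
    (hP : (P : ℝ)⁻¹ = (p₀ : ℝ)⁻¹ - (n : ℝ)⁻¹) {w : E n → ℝ} {X : E n → E n}
    (hw : LocallyIntegrable w) (hwc : HasCompactSupport w) (hX : AEStronglyMeasurable X volume)
    (hweak : ∀ ψ : E n → ℝ, IsTestFunction univ ψ →
      ∫ x, w x • gradient ψ x = -∫ x, ψ x • X x) :
    eLpNorm w P volume ≤ gnsConst n p₀ * eLpNorm X p₀ volume := by
  -- The ratio of the radii stays equal to $2$: a.e. convergence for a merely locally integrable
  -- function requires a bounded ratio.
  let B : ℕ → ContDiffBump (0 : E n) := fun k =>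
    { rIn := 1 / ((k : ℝ) + 1)
      rOut := 2 * (1 / ((k : ℝ) + 1))
      rIn_pos := by positivity
      rIn_lt_rOut := by
        have : (0 : ℝ) < 1 / ((k : ℝ) + 1) := by positivity
        linarith }
  have hB : Tendsto (fun k => (B k).rOut) atTop (𝓝 0) := by
    have h := (tendsto_one_div_add_atTop_nhds_zero_nat (𝕜 := ℝ)).const_mul 2
    rwa [mul_zero] at h
  have hae := ContDiffBump.ae_convolution_tendsto_right_of_locallyIntegrable (μ := volume) (K := 2)
    hB (Eventually.of_forall fun k => le_rfl) hw
  let ρ : ℕ → E n → ℝ := fun k => (B k).normed volume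
  have hρ : ∀ k, ContDiff ℝ ∞ (ρ k) := fun k => (B k).contDiff_normed
  have hρc : ∀ k, HasCompactSupport (ρ k) := fun k => (B k).hasCompactSupport_normed
  have hρ1 : ∀ k, ∫⁻ x, ‖ρ k x‖ₑ = 1 := by
    intro k
    have h1 := (B k).integral_normed (μ := volume)
    have h2 : ∫⁻ x, ‖ρ k x‖ₑ = ∫⁻ x, ENNReal.ofReal (ρ k x) :=
      lintegral_congr fun x => Real.enorm_of_nonneg ((B k).nonneg_normed x)
    rw [h2, ← ofReal_integral_eq_lintegral_ofReal (B k).integrable_normed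
      (Eventually.of_forall fun x => (B k).nonneg_normed x), h1, ENNReal.ofReal_one]
  have hsm : ∀ k, ContDiff ℝ ∞ (convolution (ρ k) w (lsmul ℝ ℝ) volume) := fun k =>
    (hρc k).contDiff_convolution_left (n := ⊤) _ (hρ k) hw
  refine (Lp.eLpNorm_lim_le_liminf_eLpNorm
    (fun k => (hsm k).continuous.aestronglyMeasurable) w hae).trans ?_
  refine liminf_le_of_le (by isBoundedDefault) fun b hb => ?_
  obtain ⟨k, hk⟩ := hb.exists
  refine hk.trans ?_
  refine (eLpNorm_le_eLpNorm_gradient hp₀ hn hP ((hsm k).of_le (by simp))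
    (HasCompactSupport.convolution _ (hρc k) hwc)).trans ?_
  gcongr
  have hconv : (convolution (ρ k) w (lsmul ℝ ℝ) volume) = (fun x => ∫ t, ρ k (x - t) • w t) := by
    ext1 x; exact convolution_lsmul_swap
  rw [hconv]
  calc eLpNorm (gradient fun x => ∫ t, ρ k (x - t) • w t) p₀ volume
      = eLpNorm (fun x => ∫ t, ρ k (x - t) • X t) p₀ volume :=
        eLpNorm_congr_norm_ae (Eventually.of_forall fun x =>
          norm_gradient_convolution (hρ k) (hρc k) hw hweak x)
    _ ≤ _ := eLpNorm_convolution_le (hρ k).continuous (hρ1 k) hX hp₀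

lemma gradient_mul' {φ ψ : E n → ℝ} (hφ : ContDiff ℝ ∞ φ) (hψ : ContDiff ℝ ∞ ψ) (x : E n) :
    gradient (fun y => φ y * ψ y) x = φ x • gradient ψ x + ψ x • gradient φ x := by
  have h1 := (hφ.differentiable (by simp)) x
  have h2 := (hψ.differentiable (by simp)) x
  unfold gradient
  rw [fderiv_fun_mul h1 h2, map_add]
  simp

/-- The product rule for a cutoff function times a weakly differentiable function. -/
lemma IsWeakGradient.cutoff_mul {Ω : Set (E n)} {u η : E n → ℝ} {Du : E n → E n}
    (hu : IsWeakGradient Ω u Du) (hη : IsTestFunction Ω η) {ψ : E n → ℝ}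
    (hψ : IsTestFunction univ ψ) :
    ∫ x, (η x * u x) • gradient ψ x = -∫ x, ψ x • (η x • Du x + u x • gradient η x) := by
  have hK : IsCompact (tsupport η) := hη.2.1
  have hηψ : IsTestFunction Ω fun x => η x * ψ x :=
    ⟨hη.1.mul hψ.1, hη.2.1.mul_right, (tsupport_mul_subset_left).trans hη.2.2⟩
  have hw := hu.2.2 _ hηψ
  have huK : IntegrableOn u (tsupport η) := hu.1.integrableOn_compact_subset hη.2.2 hK
  have hDuK : IntegrableOn Du (tsupport η) := hu.2.1.integrableOn_compact_subset hη.2.2 hK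
  rw [setIntegral_eq_integral_of_forall_compl_eq_zero
      (fun x hx => by rw [hηψ.gradient_eq_zero hx, smul_zero]),
    setIntegral_eq_integral_of_forall_compl_eq_zero
      (fun x hx => by rw [hηψ.eq_zero hx, zero_smul])] at hw
  have zη : ∀ x, x ∉ tsupport η → η x = 0 := fun x hx => image_eq_zero_of_notMem_tsupport hx
  have zη' : ∀ x, x ∉ tsupport η → gradient η x = 0 :=
    fun x hx => gradient_eq_zero_of_notMem_tsupport hx
  have int_of : ∀ (v : E n → E n), IntegrableOn v (tsupport η) →
      (∀ x, x ∉ tsupport η → v x = 0) → Integrable v := by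
    intro v hv hz
    exact (integrableOn_iff_integrable_of_support_subset fun x hx => by
      by_contra h; exact hx (hz x h)).1 hv
  have i1 : Integrable fun x => (η x * u x) • gradient ψ x := by
    refine int_of _ ?_ fun x hx => by rw [zη x hx]; simp
    have := huK.smul_continuousOn (g := fun x => η x • gradient ψ x)
      ((hη.1.continuous.smul hψ.continuous_gradient).continuousOn) hK
    refine this.congr_fun (fun x _ => ?_) hK.measurableSet
    simp only [smul_smul, mul_comm]
  have i2 : Integrable fun x => ψ x • (η x • Du x) := by
    refine int_of _ ?_ fun x hx => by rw [zη x hx]; simp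
    have := hDuK.continuousOn_smul (f := fun x => ψ x * η x)
      ((hψ.1.continuous.mul hη.1.continuous).continuousOn) hK
    refine this.congr_fun (fun x _ => ?_) hK.measurableSet
    simp only [smul_smul]
  have i3 : Integrable fun x => ψ x • (u x • gradient η x) := by
    refine int_of _ ?_ fun x hx => by rw [zη' x hx]; simp
    have := huK.smul_continuousOn (g := fun x => ψ x • gradient η x)
      ((hψ.1.continuous.smul hη.continuous_gradient).continuousOn) hK
    refine this.congr_fun (fun x _ => ?_) hK.measurableSet
    simp only [smul_smul, mul_comm]
  have e1 : ∫ x, u x • gradient (fun x => η x * ψ x) x =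
      (∫ x, (η x * u x) • gradient ψ x) + ∫ x, ψ x • (u x • gradient η x) := by
    rw [← integral_add i1 i3]
    refine integral_congr_ae (Eventually.of_forall fun x => ?_)
    simp only [gradient_mul' hη.1 hψ.1, smul_add, smul_smul]
    congr 2 <;> ring
  have e2 : ∫ x, (η x * ψ x) • Du x = ∫ x, ψ x • (η x • Du x) := by
    refine integral_congr_ae (Eventually.of_forall fun x => ?_)
    simp only [smul_smul, mul_comm]
  have e3 : ∫ x, ψ x • (η x • Du x + u x • gradient η x) =
      (∫ x, ψ x • (η x • Du x)) + ∫ x, ψ x • (u x • gradient η x) := by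
    rw [← integral_add i2 i3]
    simp only [smul_add]
  rw [e1, e2] at hw
  rw [e3, neg_add, ← hw, add_neg_cancel_right]

/-- The local Sobolev embedding. -/
lemma IsWeakGradient.memLp_ball {p₀ P : ℝ≥0} (hp₀ : 1 ≤ p₀) (hn : 0 < n)
    (hP : (P : ℝ)⁻¹ = (p₀ : ℝ)⁻¹ - (n : ℝ)⁻¹) {Ω : Set (E n)} {u : E n → ℝ} {Du : E n → E n}
    (hu : IsWeakGradient Ω u Du) {y : E n} {ρ : ℝ} (hρ : 0 < ρ)
    (hball : Metric.closedBall y (2 * ρ) ⊆ Ω)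
    (hu0 : MemLp u p₀ (volume.restrict (Metric.closedBall y (2 * ρ))))
    (hDu0 : MemLp Du p₀ (volume.restrict (Metric.closedBall y (2 * ρ)))) :
    MemLp u P (volume.restrict (Metric.ball y ρ)) := by
  let η : ContDiffBump y := ⟨ρ, 2 * ρ, hρ, by linarith⟩
  set K := Metric.closedBall y (2 * ρ) with hK
  have hKm : MeasurableSet K := Metric.isClosed_closedBall.measurableSet
  have hts : tsupport η = K := η.tsupport_eq
  have hη : IsTestFunction Ω η := ⟨η.contDiff, η.hasCompactSupport, by rw [hts]; exact hball⟩
  have zη : ∀ x, x ∉ K → η x = 0 := fun x hx =>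
    image_eq_zero_of_notMem_tsupport (by rwa [hts])
  have zη' : ∀ x, x ∉ K → gradient η x = 0 :=
    fun x hx => gradient_eq_zero_of_notMem_tsupport (by rwa [hts])
  obtain ⟨C, hC⟩ := (isCompact_closedBall y (2 * ρ)).exists_bound_of_continuousOn
    hη.continuous_gradient.continuousOn
  have memLp_of : ∀ {F : Type} [NormedAddCommGroup F] (v : E n → F),
      MemLp v p₀ (volume.restrict K) → (∀ x, x ∉ K → v x = 0) → MemLp v p₀ volume := by
    intro F _ v hv hz
    have hv' := (memLp_indicator_iff_restrict hKm).2 hv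
    have hvK : K.indicator v = v := by
      refine indicator_eq_self.2 fun x hx => ?_
      by_contra h
      exact hx (hz x h)
    rwa [hvK] at hv'
  have hp₀' : (1 : ℝ≥0∞) ≤ p₀ := by exact_mod_cast hp₀
  have hwL : MemLp (fun x => η x * u x) p₀ volume := by
    refine memLp_of _ ?_ fun x hx => by rw [zη x hx, zero_mul]
    refine hu0.of_le_mul (c := 1) (η.continuous.aestronglyMeasurable.mul hu0.1)
      (Eventually.of_forall fun x => ?_)
    rw [norm_mul, Real.norm_of_nonneg η.nonneg]
    exact mul_le_mul_of_nonneg_right η.le_one (norm_nonneg _)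
  have hX1 : MemLp (fun x => η x • Du x) p₀ volume := by
    refine memLp_of _ ?_ fun x hx => by rw [zη x hx, zero_smul]
    refine hDu0.of_le_mul (c := 1) (η.continuous.aestronglyMeasurable.smul hDu0.1)
      (Eventually.of_forall fun x => ?_)
    rw [norm_smul, Real.norm_of_nonneg η.nonneg]
    exact mul_le_mul_of_nonneg_right η.le_one (norm_nonneg _)
  have hX2 : MemLp (fun x => u x • gradient η x) p₀ volume := by
    refine memLp_of _ ?_ fun x hx => by rw [zη' x hx, smul_zero]
    refine hu0.of_le_mul (c := C) (hu0.1.smul hη.continuous_gradient.aestronglyMeasurable) ?_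
    filter_upwards [ae_restrict_mem hKm] with x hx
    rw [norm_smul, mul_comm]
    exact mul_le_mul_of_nonneg_right (hC x hx) (norm_nonneg _)
  -- The weak gradient of $\eta u$ is $\eta Du+u\nabla\eta$; its second part is in $L^{p_0}$ because
  -- $u$ is, on the larger ball.
  have hX := hX1.add hX2
  have hfin := eLpNorm_le_of_weakGradient_univ hp₀ hn hP (hwL.locallyIntegrable hp₀')
    (η.hasCompactSupport.mul_right) hX.1 fun ψ hψ => hu.cutoff_mul hη hψ
  have hwP : MemLp (fun x => η x * u x) P volume :=
    ⟨hwL.1, hfin.trans_lt (ENNReal.mul_lt_top ENNReal.coe_lt_top hX.2)⟩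
  refine (memLp_congr_ae ?_).1 (hwP.restrict (Metric.ball y ρ))
  filter_upwards [ae_restrict_mem Metric.isOpen_ball.measurableSet] with x hx
  rw [η.one_of_mem_closedBall (Metric.ball_subset_closedBall hx), one_mul]

end SobolevLocal

/-! ### Bounds for the exponents -/

section Exponents

/-- `sInf` of a set unbounded below is $0$ in `ℝ`, so positivity already forces boundedness below.
-/
lemma lower_le_of_pos {p : E n → ℝ} {S : Set (E n)} (h : 0 < lower p S) {x : E n} (hx : x ∈ S) :
    lower p S ≤ p x := by
  have hb : BddBelow (p '' S) := by
    by_contra hcon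
    unfold lower at h
    rw [Real.sInf_of_not_bddBelow hcon] at h
    exact lt_irrefl _ h
  exact csInf_le hb (mem_image_of_mem p hx)

variable {p : E n → ℝ} {D : Set (E n)} {a : ℝ}

/-- The Sobolev exponent of the lower bound `a` bounds `(p*)⁻` from below. -/
lemma le_lower_sobolevExp (ha : 1 < a) (hap : ∀ x ∈ D, a ≤ p x) (hpn : ∀ x ∈ D, p x < n)
    (hD : D.Nonempty) : a * n / (n - a) ≤ lower (sobolevExp p) D := by
  refine le_csInf (hD.image _) ?_
  rintro _ ⟨x, hx, rfl⟩
  have h1 := hap x hx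
  have h2 := hpn x hx
  have hn : (0 : ℝ) < n := by linarith
  unfold sobolevExp
  rw [div_le_div_iff₀ (by linarith) (by linarith)]
  have h3 : a * (n * n : ℝ) ≤ p x * (n * n) := by gcongr
  linarith

lemma lower_sobolevExp_le (ha : 1 < a) (hap : ∀ x ∈ D, a ≤ p x) (hpn : ∀ x ∈ D, p x < n)
    {x : E n} (hx : x ∈ D) : lower (sobolevExp p) D ≤ sobolevExp p x := by
  refine csInf_le ⟨0, ?_⟩ (mem_image_of_mem _ hx)
  rintro _ ⟨x, hx, rfl⟩
  have h1 := hap x hx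
  have h2 := hpn x hx
  unfold sobolevExp
  exact div_nonneg (mul_nonneg (by linarith) (by linarith)) (by linarith)

/-- The exponent `p₀` whose Sobolev conjugate is `(p*)⁻` lies between `a` and `p`. -/
lemma exists_exponent (ha : 1 < a) (hap : ∀ x ∈ D, a ≤ p x) (hpn : ∀ x ∈ D, p x < n)
    (hD : D.Nonempty) :
    ∃ p₀ : ℝ, 1 < p₀ ∧ p₀ < lower (sobolevExp p) D ∧ (∀ x ∈ D, p₀ ≤ p x) ∧
      (lower (sobolevExp p) D)⁻¹ = p₀⁻¹ - (n : ℝ)⁻¹ := by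
  obtain ⟨x₀, hx₀⟩ := hD
  have h1 := hap x₀ hx₀
  have h2 := hpn x₀ hx₀
  have hn : (0 : ℝ) < n := by linarith
  have hP := le_lower_sobolevExp ha hap hpn ⟨x₀, hx₀⟩
  set P := lower (sobolevExp p) D with hPdef
  have hP0 : 0 < P := lt_of_lt_of_le (div_pos (by positivity) (by linarith)) hP
  rw [div_le_iff₀ (by linarith)] at hP
  -- This solves $1/P=1/p_0-1/n$. Since $q\mapsto q^*$ is increasing, $a^*\le P\le p^*(x)$ gives
  -- $a\le p_0\le p(x)$.
  refine ⟨n * P / (n + P), ?_, ?_, fun x hx => ?_, ?_⟩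
  · rw [lt_div_iff₀ (by positivity)]; nlinarith
  · rw [div_lt_iff₀ (by positivity)]; nlinarith
  · have h3 := lower_sobolevExp_le ha hap hpn hx
    have h4 := hap x hx
    have h5 := hpn x hx
    rw [← hPdef, sobolevExp, le_div_iff₀ (by linarith)] at h3
    rw [div_le_iff₀ (by positivity)]
    nlinarith
  · field_simp; ring

end Exponents

/-! ### Integrability -/

section Integrability

open ENNReal

lemma MemVarLp.mono_set {F : Type*} [NormedAddCommGroup F] [NormedSpace ℝ F] {e : E n → ℝ}
    {S T : Set (E n)} {v : E n → F} (hv : MemVarLp e T v) (h : S ⊆ T) : MemVarLp e S v := by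
  obtain ⟨hm, l, hl, hlt⟩ := hv
  exact ⟨hm.mono_measure (Measure.restrict_mono h le_rfl), l, hl,
    (lintegral_mono_set h).trans_lt hlt⟩

/-- The bound $M$ on $e'$ makes the factor $l^{e'(x)}$ from the rescaling bounded; lowering the
exponent from $e$ to $e'$ costs a constant, integrable on a set of finite measure. -/
lemma MemVarLp.integrableOn_rpow {F : Type*} [NormedAddCommGroup F] [NormedSpace ℝ F]
    {e e' : E n → ℝ} {S : Set (E n)} (hS : MeasurableSet S) (hSfin : volume S ≠ ⊤) {v : E n → F}
    {M : ℝ} (hv : MemVarLp e S v) (he' : AEMeasurable e' (volume.restrict S))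
    (h0 : ∀ x ∈ S, 0 < e' x) (hle : ∀ x ∈ S, e' x ≤ e x) (hM : ∀ x ∈ S, e' x ≤ M) :
    IntegrableOn (fun x => ‖v x‖ ^ e' x) S := by
  obtain ⟨hm, l, hl, hlt⟩ := hv
  have hmeas : AEStronglyMeasurable (fun x => ‖v x‖ ^ e' x) (volume.restrict S) :=
    (hm.norm.aemeasurable.pow he').aestronglyMeasurable
  refine ⟨hmeas, ?_⟩
  rw [hasFiniteIntegral_iff_norm]
  have hbound : ∀ x ∈ S, ENNReal.ofReal ‖‖v x‖ ^ e' x‖ ≤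
      ENNReal.ofReal (max 1 l ^ M) * (1 + ENNReal.ofReal (‖l⁻¹ • v x‖ ^ e x)) := by
    intro x hx
    rw [← ENNReal.ofReal_one, ← ENNReal.ofReal_add zero_le_one (by positivity),
      ← ENNReal.ofReal_mul (by positivity), Real.norm_of_nonneg (by positivity)]
    refine ENNReal.ofReal_le_ofReal ((rpow_le_of_modular hl (h0 x hx) (hle x hx)).trans ?_)
    gcongr
    calc l ^ e' x ≤ max 1 l ^ e' x := by
          have := h0 x hx
          gcongr
          exact le_max_right _ _
      _ ≤ _ := Real.rpow_le_rpow_of_exponent_le (le_max_left _ _) (hM x hx)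
  refine (setLIntegral_mono' hS hbound).trans_lt ?_
  rw [lintegral_const_mul' _ _ ENNReal.ofReal_ne_top, lintegral_add_left measurable_const]
  refine ENNReal.mul_lt_top ENNReal.ofReal_lt_top (ENNReal.add_lt_top.2 ⟨?_, hlt⟩)
  simpa using hSfin.lt_top

lemma MemVarLp.memLp {F : Type*} [NormedAddCommGroup F] [NormedSpace ℝ F]
    {e : E n → ℝ} {S : Set (E n)} (hS : MeasurableSet S) (hSfin : volume S ≠ ⊤) {v : E n → F}
    {p₀ : NNReal} (hp₀ : p₀ ≠ 0) (hv : MemVarLp e S v) (hle : ∀ x ∈ S, p₀ ≤ e x) :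
    MemLp v p₀ (volume.restrict S) := by
  have hpos : 0 < p₀ := pos_iff_ne_zero.2 hp₀
  have := hv.integrableOn_rpow (e' := fun _ => p₀) (M := p₀) hS hSfin aemeasurable_const
    (fun _ _ => by exact_mod_cast hpos) hle (fun _ _ => le_rfl)
  refine (integrable_norm_rpow_iff hv.1 (by simpa using hp₀) (by simp)).1 ?_
  simpa [IntegrableOn] using this

variable {p r σ b f g h : E n → ℝ} {ε t c : ℝ} {D : Set (E n)}

lemma aemeasurable_bigB {μ : Measure (E n)} (hp : AEMeasurable p μ) (hr : AEMeasurable r μ)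
    (hb : AEMeasurable b μ) : AEMeasurable (bigB p r ε c b) μ := by
  unfold bigB
  exact ((hb.add (hb.pow (hp.div (hp.sub_const 1)))).add
    (hb.pow (hr.div ((hr.sub_const ε).sub_const 1)))).const_mul c

lemma aemeasurable_zCoeff {μ : Measure (E n)} (hp : AEMeasurable p μ) (hr : AEMeasurable r μ)
    (hb : AEMeasurable b μ) (hf : AEMeasurable f μ) (hg : AEMeasurable g μ)
    (hh : AEMeasurable h μ) : AEMeasurable (zCoeff p r ε c b f g h D) μ := by
  have hB := aemeasurable_bigB (ε := ε) (c := c) hp hr hb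
  have h1 : AEMeasurable (conjExp p) μ := hp.div (hp.sub_const 1)
  have h2 : AEMeasurable (conjExp r) μ := hr.div (hr.sub_const 1)
  unfold zCoeff
  exact ((((((hb.const_add 1).add hf).add (hg.pow h1)).add (hh.pow h2)).add hB).add
    (hB.pow_const _))

lemma aemeasurable_integrandJ {μ : Measure (E n)} (hp : AEMeasurable p μ) (hr : AEMeasurable r μ)
    (hb : AEMeasurable b μ) (hf : AEMeasurable f μ) (hg : AEMeasurable g μ)
    (hh : AEMeasurable h μ) {v : E n → ℝ} {Dv : E n → E n} (hv : AEMeasurable v μ)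
    (hDv : AEStronglyMeasurable Dv μ) :
    AEMeasurable (fun x => integrandJ p r ε c b f g h D x (v x) (Dv x)) μ := by
  unfold integrandJ
  exact ((hDv.norm.aemeasurable.pow hp).add ((aemeasurable_bigB hp hr hb).mul
    ((hv.norm).pow hr))).add (aemeasurable_zCoeff hp hr hb hf hg hh)

lemma add_three_rpow_le {x y z κ : ℝ} (hx : 0 ≤ x) (hy : 0 ≤ y) (hz : 0 ≤ z) (hκ : 0 ≤ κ) :
    (x + y + z) ^ κ ≤ 3 ^ κ * (x ^ κ + y ^ κ + z ^ κ) := by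
  have hx' : 0 ≤ x ^ κ := by positivity
  have hy' : 0 ≤ y ^ κ := by positivity
  have hz' : 0 ≤ z ^ κ := by positivity
  have key : ∀ m, 0 ≤ m → x ≤ m → y ≤ m → z ≤ m → m ^ κ ≤ x ^ κ + y ^ κ + z ^ κ →
      (x + y + z) ^ κ ≤ 3 ^ κ * (x ^ κ + y ^ κ + z ^ κ) := by
    intro m hm h1 h2 h3 h4
    calc (x + y + z) ^ κ ≤ (3 * m) ^ κ := by
          apply Real.rpow_le_rpow (by positivity) (by linarith) hκ
      _ = 3 ^ κ * m ^ κ := Real.mul_rpow (by norm_num) hm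
      _ ≤ _ := by gcongr
  rcases le_total x y with h1 | h1 <;> rcases le_total y z with h2 | h2 <;>
    rcases le_total x z with h3 | h3
  · exact key z hz h3 h2 le_rfl (by linarith)
  · exact key z hz (h1.trans h2) h2 le_rfl (by linarith)
  · exact key y hy h1 le_rfl h2 (by linarith)
  · exact key y hy h1 le_rfl h2 (by linarith)
  · exact key z hz h3 h2 le_rfl (by linarith)
  · exact key x hx le_rfl h1 h3 (by linarith)
  · exact key x hx le_rfl h1 (h2.trans h1) (by linarith)
  · exact key x hx le_rfl h1 h3 (by linarith)

/-- The exponents of `b` in `𝔹` are at most `p / (p - ε - 1)`. -/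
lemma exponents_le {p r ε a : ℝ} (hε : 0 < ε) (ha : 1 + ε < a) (hap : a ≤ p) (hpr : p ≤ r) :
    1 ≤ p / (p - ε - 1) ∧ p / (p - 1) ≤ p / (p - ε - 1) ∧
      r / (r - ε - 1) ≤ p / (p - ε - 1) ∧ p / (p - ε - 1) ≤ a / (a - ε - 1) := by
  refine ⟨?_, ?_, ?_, ?_⟩
  · rw [le_div_iff₀ (by linarith)]; linarith
  · exact div_le_div_of_nonneg_left (by linarith) (by linarith) (by linarith)
  · rw [div_le_div_iff₀ (by linarith) (by linarith)]; nlinarith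
  · rw [div_le_div_iff₀ (by linarith) (by linarith)]; nlinarith

/-- By `exponents_le` the left side dominates every exponent of $b$ occurring in $\mathbb B^\kappa$,
so the integrability assumed of $b$ suffices for that summand of $z$. -/
lemma le_coeffExp {x : E n} {a : ℝ} (hε : 0 < ε) (ht : 1 ≤ t) (hκ : 1 ≤ critExp p r D)
    (ha : 1 + ε < a) (hap : a ≤ p x) :
    p x / (p x - ε - 1) * critExp p r D ≤ coeffExp p r σ ε t D x := by
  have h1 : 0 < p x - ε - 1 := by linarith
  have h2 : 0 < p x := by linarith
  unfold coeffExp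
  have h3 : critExp p r D ≤ max (σ x) (t * critExp p r D) := by
    refine le_max_of_le_right ?_
    nlinarith
  have h4 : p x / (p x - ε - 1) ≤ p x * (1 + ε) / (p x - ε - 1) := by
    gcongr
    nlinarith
  gcongr

/-- The decisive summand is $\mathbb B^\kappa$; since $\kappa\ge1$, those with $b$ and $\mathbb B$
follow from $x\le1+x^\kappa$. The data $f$, $g^{p'}$, $h^{r'}$ are integrable because $t\ge1$ and
the measure is finite. -/
lemma integrableOn_zCoeff {a : ℝ} (hD : MeasurableSet D) (hDfin : volume D ≠ ⊤)
    (hε : 0 < ε) (hc : 0 < c) (ht : 1 ≤ t) (hκ : 1 ≤ critExp p r D)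
    (ha : 1 + ε < a) (hap : ∀ x ∈ D, a ≤ p x) (hpr : ∀ x ∈ D, p x ≤ r x)
    (hp : AEMeasurable p (volume.restrict D)) (hr : AEMeasurable r (volume.restrict D))
    (hb0 : ∀ᵐ x ∂volume.restrict D, 0 ≤ b x) (hg0 : ∀ᵐ x ∂volume.restrict D, 0 ≤ g x)
    (hh0 : ∀ᵐ x ∂volume.restrict D, 0 ≤ h x)
    (hf : MemLp f (ENNReal.ofReal t) (volume.restrict D))
    (hg : MemVarLp (fun x => t * conjExp p x) D g)
    (hh : MemVarLp (fun x => t * conjExp r x) D h)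
    (hb : MemVarLp (coeffExp p r σ ε t D) D b) :
    IntegrableOn (zCoeff p r ε c b f g h D) D := by
  have hfin : IsFiniteMeasure (volume.restrict D) := ⟨by simpa using hDfin.lt_top⟩
  set κ := critExp p r D with hκdef
  have hbm : AEMeasurable b (volume.restrict D) := hb.1.aemeasurable
  have ifi : IntegrableOn f D := hf.integrable (by simpa using ht)
  have iconj : ∀ (q k : E n → ℝ), (∀ x ∈ D, a ≤ q x) → AEMeasurable q (volume.restrict D) →
      (∀ᵐ x ∂volume.restrict D, 0 ≤ k x) → MemVarLp (fun x => t * conjExp q x) D k →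
      IntegrableOn (fun x => k x ^ conjExp q x) D := by
    intro q k hq hqm hk0 hk
    have hpos : ∀ x ∈ D, 0 < conjExp q x := fun x hx => by
      have := hq x hx
      exact div_pos (by linarith) (by linarith)
    have := hk.integrableOn_rpow (e' := conjExp q) (M := a / (a - 1)) hD hDfin
      (hqm.div (hqm.sub_const 1)) hpos
      (fun x hx => le_mul_of_one_le_left (hpos x hx).le ht)
      (fun x hx => by
        have := hq x hx
        unfold conjExp
        rw [div_le_div_iff₀ (by linarith) (by linarith)]; nlinarith)
    refine this.congr ?_
    filter_upwards [hk0] with x hx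
    rw [Real.norm_of_nonneg hx]
  have ig := iconj p g hap hp hg0 hg
  have ih := iconj r h (fun x hx => (hap x hx).trans (hpr x hx)) hr hh0 hh
  have ibpow : ∀ e : E n → ℝ, AEMeasurable e (volume.restrict D) → (∀ x ∈ D, 0 < e x) →
      (∀ x ∈ D, e x ≤ p x / (p x - ε - 1)) → IntegrableOn (fun x => (b x ^ e x) ^ κ) D := by
    intro e hem he0 hele
    have := hb.integrableOn_rpow (e' := fun x => e x * κ) (M := a / (a - ε - 1) * κ) hD hDfin
      (hem.mul_const κ) (fun x hx => mul_pos (he0 x hx) (by linarith))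
      (fun x hx => (mul_le_mul_of_nonneg_right (hele x hx) (by linarith)).trans
        (le_coeffExp hε ht hκ ha (hap x hx)))
      (fun x hx => mul_le_mul_of_nonneg_right ((hele x hx).trans
        (exponents_le hε ha (hap x hx) (hpr x hx)).2.2.2) (by linarith))
    refine this.congr ?_
    filter_upwards [hb0] with x hx
    rw [Real.norm_of_nonneg hx, Real.rpow_mul hx]
  have ib1 := ibpow (fun _ => 1) aemeasurable_const (fun _ _ => one_pos)
    (fun x hx => (exponents_le hε ha (hap x hx) (hpr x hx)).1)
  have ib2 := ibpow (fun x => p x / (p x - 1)) (hp.div (hp.sub_const 1))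
    (fun x hx => by have := hap x hx; exact div_pos (by linarith) (by linarith))
    (fun x hx => (exponents_le hε ha (hap x hx) (hpr x hx)).2.1)
  have ib3 := ibpow (fun x => r x / (r x - ε - 1))
    (hr.div ((hr.sub_const ε).sub_const 1))
    (fun x hx => by
      have := hap x hx; have := hpr x hx
      exact div_pos (by linarith) (by linarith))
    (fun x hx => (exponents_le hε ha (hap x hx) (hpr x hx)).2.2.1)
  simp only [Real.rpow_one] at ib1
  have hBm := aemeasurable_bigB (ε := ε) (c := c) hp hr hbm
  have i1 : IntegrableOn (fun _ : E n => (1 : ℝ)) D := integrable_const _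
  have iBκ : IntegrableOn (fun x => bigB p r ε c b x ^ κ) D := by
    refine Integrable.mono' (((ib1.add ib2).add ib3).const_mul (c ^ κ * 3 ^ κ))
      (hBm.pow_const _).aestronglyMeasurable ?_
    filter_upwards [hb0] with x hx
    rw [Real.norm_of_nonneg (Real.rpow_nonneg (bigB_nonneg hc hx) _)]
    unfold bigB
    rw [Real.mul_rpow hc.le (by positivity), mul_assoc]
    refine mul_le_mul_of_nonneg_left ?_ (by positivity)
    exact add_three_rpow_le hx (by positivity) (by positivity) (by linarith)
  have iB : IntegrableOn (bigB p r ε c b) D := by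
    refine Integrable.mono' (i1.add iBκ) hBm.aestronglyMeasurable ?_
    filter_upwards [hb0] with x hx
    have h0 := bigB_nonneg (p := p) (r := r) (ε := ε) hc hx
    rw [Real.norm_of_nonneg h0]
    simpa using rpow_le_one_add_rpow h0 zero_le_one hκ
  have ib : IntegrableOn b D := by
    refine Integrable.mono' (i1.add ib1) hbm.aestronglyMeasurable ?_
    filter_upwards [hb0] with x hx
    rw [Real.norm_of_nonneg hx]
    simpa using rpow_le_one_add_rpow hx zero_le_one hκ
  exact ((((((i1.add ib).add ifi).add ig).add ih).add iB).add iBκ)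

end Integrability

/-! ### Restriction to open subsets -/

section Restriction

lemma IsWeakGradient.mono {Ω U : Set (E n)} {u : E n → ℝ} {Du : E n → E n}
    (hΩ : MeasurableSet Ω) (h : U ⊆ Ω) (hu : IsWeakGradient Ω u Du) : IsWeakGradient U u Du := by
  refine ⟨hu.1.mono_set h, hu.2.1.mono_set h, fun φ hφ => ?_⟩
  have := hu.2.2 φ (hφ.mono h)
  rwa [setIntegral_eq_of_subset_of_forall_sdiff_eq_zero hΩ h
      (fun x hx => by rw [hφ.gradient_eq_zero hx.2, smul_zero]),
    setIntegral_eq_of_subset_of_forall_sdiff_eq_zero hΩ h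
      (fun x hx => by rw [hφ.eq_zero hx.2, zero_smul])] at this

lemma MemSobolev.mono {p : E n → ℝ} {Ω U : Set (E n)} {u : E n → ℝ} {Du : E n → E n}
    (hΩ : MeasurableSet Ω) (h : U ⊆ Ω) (hu : MemSobolev p Ω u Du) : MemSobolev p U u Du :=
  ⟨hu.1.mono hΩ h, hu.2.1.mono_set h, hu.2.2.mono_set h⟩

lemma MemSobolev.memSobolevLoc {p : E n → ℝ} {Ω U : Set (E n)} {u : E n → ℝ} {Du : E n → E n}
    (hΩ : MeasurableSet Ω) (h : U ⊆ Ω) (hu : MemSobolev p Ω u Du) : MemSobolevLoc p U u Du :=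
  ⟨hu.1.mono hΩ h, fun _ _ hV => hu.mono hΩ ((subset_closure.trans hV.2).trans h)⟩

end Restriction

/-! ### Testing the equation with Sobolev functions -/

section Testing

open NNReal ENNReal

lemma integrable_rpow_of_eLpNorm_le {F : Type*} [NormedAddCommGroup F] {μ : Measure (E n)}
    {v : E n → F} {P : ℝ≥0} {δ : ℝ} (hP : P ≠ 0) (hδ : 0 ≤ δ) (hv : AEStronglyMeasurable v μ)
    (h : eLpNorm v P μ ≤ ENNReal.ofReal δ) :
    Integrable (fun x => ‖v x‖ ^ (P : ℝ)) μ ∧ ∫ x, ‖v x‖ ^ (P : ℝ) ∂μ ≤ δ ^ (P : ℝ) := by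
  have hP0 : (0 : ℝ) < P := by
    have : 0 < P := pos_iff_ne_zero.2 hP
    exact_mod_cast this
  have hmem : MemLp v P μ := ⟨hv, h.trans_lt ENNReal.ofReal_lt_top⟩
  have hi : Integrable (fun x => ‖v x‖ ^ (P : ℝ)) μ := by
    simpa using hmem.integrable_norm_rpow (by simpa using hP) (by simp)
  refine ⟨hi, ?_⟩
  rw [eLpNorm_eq_lintegral_ofReal hP, ← ofReal_integral_eq_lintegral_ofReal hi
    (Filter.Eventually.of_forall fun x => by positivity),
    ENNReal.ofReal_rpow_of_nonneg (integral_nonneg fun x => by positivity) (by positivity),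
    ENNReal.ofReal_le_ofReal_iff hδ, one_div,
    Real.rpow_inv_le_iff_of_pos (integral_nonneg fun x => by positivity) hδ hP0] at h
  exact h

lemma integrable_of_modular_le {F : Type*} [NormedAddCommGroup F] {S : Set (E n)} {p : E n → ℝ}
    {v : E n → F} {δ : ℝ} (hδ : 0 ≤ δ) (hv : AEStronglyMeasurable v (volume.restrict S))
    (hp : AEMeasurable p (volume.restrict S)) (h : modular p S v ≤ ENNReal.ofReal δ) :
    IntegrableOn (fun x => ‖v x‖ ^ p x) S ∧ ∫ x in S, ‖v x‖ ^ p x ≤ δ := by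
  have hm : AEStronglyMeasurable (fun x => ‖v x‖ ^ p x) (volume.restrict S) :=
    (hv.norm.aemeasurable.pow hp).aestronglyMeasurable
  have hi : IntegrableOn (fun x => ‖v x‖ ^ p x) S :=
    (lintegral_ofReal_ne_top_iff_integrable hm
      (Filter.Eventually.of_forall fun x => by positivity)).1 (ne_top_of_le_ne_top (by simp) h)
  refine ⟨hi, ?_⟩
  unfold modular at h
  rwa [← ofReal_integral_eq_lintegral_ofReal hi
    (Filter.Eventually.of_forall fun x => by positivity), ENNReal.ofReal_le_ofReal_iff hδ] at h

variable {p : E n → ℝ} {S : Set (E n)} {p₀ P : ℝ≥0} {w : E n → ℝ} {X : E n → E n} {R : ℝ}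

/-- The Sobolev inequality in terms of integrals. -/
lemma MemSobolevZero.integral_rpow_le (hS : MeasurableSet S) (hSfin : volume S ≠ ⊤)
    (hp₀ : 1 ≤ p₀) (hn : 0 < n) (hP : (P : ℝ)⁻¹ = (p₀ : ℝ)⁻¹ - (n : ℝ)⁻¹) (hP0 : P ≠ 0)
    (hpm : AEMeasurable p (volume.restrict S)) (hp : ∀ x ∈ S, p₀ ≤ p x) (hpR : ∀ x ∈ S, p x ≤ R)
    (hw : MemSobolevZero p S w X) :
    IntegrableOn (fun x => ‖X x‖ ^ p x) S ∧ IntegrableOn (fun x => ‖w x‖ ^ (P : ℝ)) S ∧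
      ∫ x in S, ‖w x‖ ^ (P : ℝ) ≤
        (gnsConst n p₀ * (∫ x in S, (1 + ‖X x‖ ^ p x)) ^ (1 / (p₀ : ℝ))) ^ (P : ℝ) := by
  have hfin : IsFiniteMeasure (volume.restrict S) := ⟨by simpa using hSfin.lt_top⟩
  have hp₀' : (1 : ℝ) ≤ p₀ := by exact_mod_cast hp₀
  have hp₀0 : p₀ ≠ 0 := by rintro rfl; simp at hp₀
  have hX := hw.1.2.2.integrableOn_rpow (e' := p) (M := R) hS hSfin hpm
    (fun x hx => by linarith [hp x hx]) (fun _ _ => le_rfl) hpR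
  have hX1 : IntegrableOn (fun x => 1 + ‖X x‖ ^ p x) S := (integrable_const 1).add hX
  have hI : 0 ≤ ∫ x in S, (1 + ‖X x‖ ^ p x) := integral_nonneg fun x => by positivity
  have hXn : eLpNorm X p₀ (volume.restrict S) ≤
      ENNReal.ofReal ((∫ x in S, (1 + ‖X x‖ ^ p x)) ^ (1 / (p₀ : ℝ))) := by
    rw [eLpNorm_eq_lintegral_ofReal hp₀0, ← ENNReal.ofReal_rpow_of_nonneg hI (by positivity),
      ofReal_integral_eq_lintegral_ofReal hX1
        (Filter.Eventually.of_forall fun x => by positivity)]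
    refine ENNReal.rpow_le_rpow ?_ (by positivity)
    refine setLIntegral_mono' hS fun x hx => ENNReal.ofReal_le_ofReal ?_
    exact rpow_le_one_add_rpow (norm_nonneg _) (by positivity) (hp x hx)
  have hsob := (hw.sobolev hS hSfin hp₀ hn hP hp).1
  have hwn : eLpNorm w P (volume.restrict S) ≤ ENNReal.ofReal
      (gnsConst n p₀ * (∫ x in S, (1 + ‖X x‖ ^ p x)) ^ (1 / (p₀ : ℝ))) := by
    rw [ENNReal.ofReal_mul (by positivity), ENNReal.ofReal_coe_nnreal]
    exact hsob.trans (by gcongr)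
  exact ⟨hX, integrable_rpow_of_eLpNorm_le hP0 (by positivity) hw.1.2.1.1 hwn⟩

/-- Functions in `W₀^{1,p(·)}` are admissible test functions in the equation. -/
lemma MemSobolevZero.integral_pairing_eq_zero (hS : MeasurableSet S) (hSfin : volume S ≠ ⊤)
    (hp₀ : 1 ≤ p₀) (hn : 0 < n) (hP : (P : ℝ)⁻¹ = (p₀ : ℝ)⁻¹ - (n : ℝ)⁻¹) (hP1 : 1 ≤ P)
    (hpm : AEMeasurable p (volume.restrict S)) (hp : ∀ x ∈ S, p₀ ≤ p x) (hpR : ∀ x ∈ S, p x ≤ R)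
    (hw : MemSobolevZero p S w X) {a : E n → E n} {β F : E n → ℝ} (hF : IntegrableOn F S)
    (ha : AEStronglyMeasurable a (volume.restrict S))
    (hβ : AEStronglyMeasurable β (volume.restrict S))
    (hbound : ∀ η : ℝ, 0 < η → ∃ C : ℝ, 0 ≤ C ∧ ∀ᵐ x ∂volume.restrict S, ∀ (s : ℝ) (ζ : E n),
      |⟪a x, ζ⟫| + |β x * s| ≤ η * F x + C * (‖ζ‖ ^ p x + |s| ^ (P : ℝ)))
    (heq : ∀ φ, IsTestFunction S φ → ∫ x in S, ⟪a x, gradient φ x⟫ = ∫ x in S, β x * φ x) :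
    IntegrableOn (fun x => ⟪a x, X x⟫ - β x * w x) S ∧
      ∫ x in S, (⟪a x, X x⟫ - β x * w x) = 0 := by
  have hP0 : P ≠ 0 := by rintro rfl; simp at hP1
  have hP1' : (1 : ℝ) ≤ P := by exact_mod_cast hP1
  have int_of : ∀ (v : E n → ℝ) (Y : E n → E n), AEStronglyMeasurable v (volume.restrict S) →
      AEStronglyMeasurable Y (volume.restrict S) → IntegrableOn (fun x => ‖v x‖ ^ (P : ℝ)) S →
      IntegrableOn (fun x => ‖Y x‖ ^ p x) S →
      IntegrableOn (fun x => ⟪a x, Y x⟫) S ∧ IntegrableOn (fun x => β x * v x) S := by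
    intro v Y hv hY hvi hYi
    obtain ⟨C, hC, hb⟩ := hbound 1 one_pos
    have hdom : IntegrableOn (fun x => 1 * F x + C * (‖Y x‖ ^ p x + ‖v x‖ ^ (P : ℝ))) S :=
      (hF.const_mul 1).add ((hYi.add hvi).const_mul C)
    constructor
    · refine Integrable.mono' hdom (ha.inner hY) ?_
      filter_upwards [hb] with x hx
      have := hx (v x) (Y x)
      have h0 := abs_nonneg (β x * v x)
      rw [Real.norm_eq_abs, Real.norm_eq_abs]
      linarith
    · refine Integrable.mono' hdom (hβ.mul hv) ?_
      filter_upwards [hb] with x hx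
      have := hx (v x) (Y x)
      have h0 := abs_nonneg ⟪a x, Y x⟫
      rw [Real.norm_eq_abs, Real.norm_eq_abs]
      linarith
  obtain ⟨hXi, hwi, -⟩ := hw.integral_rpow_le hS hSfin hp₀ hn hP hP0 hpm hp hpR
  have hwm := hw.1.2.1.1
  have hXm := hw.1.2.2.1
  obtain ⟨j1, j2⟩ := int_of w X hwm hXm hwi hXi
  refine ⟨j1.sub j2, ?_⟩
  set I := ∫ x in S, (⟪a x, X x⟫ - β x * w x) with hI
  -- The constant $C$ is fixed by $\eta$ first, and then the approximation is chosen fine enough to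
  -- beat $C$.
  have key : ∀ η : ℝ, 0 < η → |I| ≤ η * (∫ x in S, F x) + η := by
    intro η hη
    obtain ⟨C, hC, hb⟩ := hbound η hη
    set δ := min 1 (η / (2 * (C + 1))) with hδ
    have hδ0 : 0 < δ := by positivity
    have hδ1 : δ ≤ 1 := min_le_left _ _
    have hCδ : C * (δ + δ) ≤ η := by
      have h1 : δ ≤ η / (2 * (C + 1)) := min_le_right _ _
      rw [le_div_iff₀ (by positivity)] at h1
      nlinarith
    obtain ⟨φ, hφ, h1, h2⟩ := (hw.sobolev hS hSfin hp₀ hn hP hp).2 δ hδ0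
    have hvm : AEStronglyMeasurable (fun x => φ x - w x) (volume.restrict S) :=
      hφ.1.continuous.aestronglyMeasurable.sub hwm
    have hYm : AEStronglyMeasurable (fun x => gradient φ x - X x) (volume.restrict S) :=
      hφ.continuous_gradient.aestronglyMeasurable.sub hXm
    obtain ⟨k1, k2⟩ := integrable_of_modular_le hδ0.le hYm hpm h1
    obtain ⟨k3, k4⟩ := integrable_rpow_of_eLpNorm_le hP0 hδ0.le hvm h2
    obtain ⟨j3, j4⟩ := int_of _ _ hvm hYm k3 k1
    have hδP : δ ^ (P : ℝ) ≤ δ := by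
      simpa using Real.rpow_le_rpow_of_exponent_ge hδ0 hδ1 hP1'
    have i1 : ∫ x in S, ⟪a x, gradient φ x⟫ =
        (∫ x in S, ⟪a x, X x⟫) + ∫ x in S, ⟪a x, gradient φ x - X x⟫ := by
      rw [← integral_add j1 j3]
      refine integral_congr_ae (Filter.Eventually.of_forall fun x => ?_)
      simp only [inner_sub_right, add_sub_cancel]
    have i2 : ∫ x in S, β x * φ x =
        (∫ x in S, β x * w x) + ∫ x in S, β x * (φ x - w x) := by
      rw [← integral_add j2 j4]
      refine integral_congr_ae (Filter.Eventually.of_forall fun x => ?_)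
      simp only [mul_sub, add_sub_cancel]
    have i3 := heq φ hφ
    rw [i1, i2] at i3
    -- The equation annihilates the contribution of $\varphi$, so only the approximation error
    -- remains.
    have i4 : I = -∫ x in S, (⟪a x, gradient φ x - X x⟫ - β x * (φ x - w x)) := by
      rw [hI, integral_sub j1 j2, integral_sub j3 j4]
      linarith
    have k5 : IntegrableOn (fun x => C * (‖gradient φ x - X x‖ ^ p x + ‖φ x - w x‖ ^ (P : ℝ))) S :=
      (k1.add k3).const_mul C
    rw [i4, abs_neg]
    calc |∫ x in S, (⟪a x, gradient φ x - X x⟫ - β x * (φ x - w x))|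
        ≤ ∫ x in S, (η * F x + C * (‖gradient φ x - X x‖ ^ p x + ‖φ x - w x‖ ^ (P : ℝ))) := by
          rw [← Real.norm_eq_abs]
          refine norm_integral_le_of_norm_le ((hF.const_mul η).add k5) ?_
          filter_upwards [hb] with x hx
          have := hx (φ x - w x) (gradient φ x - X x)
          rw [Real.norm_eq_abs, Real.norm_eq_abs]
          exact (abs_sub _ _).trans this
      _ = η * (∫ x in S, F x) + C * ((∫ x in S, ‖gradient φ x - X x‖ ^ p x) +
            ∫ x in S, ‖φ x - w x‖ ^ (P : ℝ)) := by
          rw [integral_add (hF.const_mul η) k5, integral_const_mul,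
            integral_const_mul, integral_add k1 k3]
      _ ≤ η * (∫ x in S, F x) + C * (δ + δ) := by
          gcongr
          exact k4.trans hδP
      _ ≤ _ := by gcongr
  have hlim : |I| ≤ 0 := by
    have hJ : 0 < |∫ x in S, F x| + 1 := by positivity
    refine le_of_forall_pos_le_add fun e he => ?_
    have h1 := key (e / (|∫ x in S, F x| + 1)) (by positivity)
    have h2 := mul_le_mul_of_nonneg_left (le_abs_self (∫ x in S, F x))
      (by positivity : 0 ≤ e / (|∫ x in S, F x| + 1))
    have h3 : e / (|∫ x in S, F x| + 1) * (|∫ x in S, F x| + 1) = e := by field_simp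
    linarith
  exact abs_eq_zero.1 (le_antisymm hlim (abs_nonneg _))

end Testing

/-! ### The quasiminimizing property -/

section Quasiminimizer

open NNReal ENNReal

/-- The middle term is controlled by $\mathbb B|u|^r\le\mathbb B+|u|^P+\mathbb B^\kappa$, whose
coefficients are part of $z$. -/
lemma integrableOn_integrandJ {p r b f g h : E n → ℝ} {ε c R P : ℝ} {D U : Set (E n)}
    {u : E n → ℝ} {Du : E n → E n} (hc : 0 < c) (hR : 0 < R) (hRP : R < P)
    (hκ : critExp p r D = P / (P - R))
    (hadm : ∀ᵐ x ∂volume.restrict U, Admissible p r ε R b f g h x) (hε : 0 < ε)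
    (hm : AEMeasurable (fun x => integrandJ p r ε c b f g h D x (u x) (Du x)) (volume.restrict U))
    (hz : IntegrableOn (zCoeff p r ε c b f g h D) U)
    (hu : IntegrableOn (fun x => ‖u x‖ ^ P) U) (hDu : IntegrableOn (fun x => ‖Du x‖ ^ p x) U) :
    IntegrableOn (fun x => integrandJ p r ε c b f g h D x (u x) (Du x)) U := by
  refine Integrable.mono' ((hDu.add hu).add (hz.const_mul 3)) hm.aestronglyMeasurable ?_
  filter_upwards [hadm] with x H
  obtain ⟨k1, k2, k3⟩ := integrandJ_parts (D := D) hc H (u x) (Du x)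
  have hp := H.one_lt
  have hpr := H.p_le_r
  have hb := H.b_nonneg
  have hf := H.f_nonneg
  have hBB := bigB_nonneg (p := p) (r := r) (ε := ε) hc hb
  have k4 := (le_zCoeff (D := D) hc H).1
  have hκ0 := Real.rpow_nonneg hBB (critExp p r D)
  have w1 := mul_le_mul_of_nonneg_left
    (rpow_le_one_add_rpow (e := r x) (abs_nonneg (u x)) (by linarith) H.r_le) hBB
  have w2 := mul_rpow_le_add (W := |u x|) (η := 1) hBB (abs_nonneg _) one_pos hR hRP
  rw [← hκ, Real.one_rpow] at w2
  rw [Real.norm_of_nonneg (by unfold integrandJ; linarith)]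
  simp only [Pi.add_apply, Real.norm_eq_abs]
  unfold integrandJ
  linarith

variable {p r σ b f g h : E n → ℝ} {ε t c μ R : ℝ} {D : Set (E n)} {p₀ P : ℝ≥0}
  {u : E n → ℝ} {Du : E n → E n} {A : E n → ℝ → E n → E n} {B : E n → ℝ → E n → ℝ}

/-- If the energy density of a weak solution is integrable on `U`, the solution is a
quasiminimizer in `U`. -/
lemma exists_isQuasiminimizer {U : Set (E n)} (hU : IsOpen U) (hUfin : volume U ≠ ⊤)
    (hc : 0 < c) (hε : 0 < ε) (hμ : 1 ≤ μ) (hR : 0 < R) (hRP : R < P)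
    (hκ : critExp p r D = P / (P - R))
    (hp₀ : 1 ≤ p₀) (hp₀P : p₀ < P) (hn : 0 < n) (hP : (P : ℝ)⁻¹ = (p₀ : ℝ)⁻¹ - (n : ℝ)⁻¹)
    (hpm : AEMeasurable p (volume.restrict U)) (hrm : AEMeasurable r (volume.restrict U))
    (hbm : AEMeasurable b (volume.restrict U)) (hfm : AEMeasurable f (volume.restrict U))
    (hgm : AEMeasurable g (volume.restrict U)) (hhm : AEMeasurable h (volume.restrict U))
    (hp : ∀ x ∈ U, p₀ ≤ p x) (hpR : ∀ x ∈ U, p x ≤ R)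
    (hadm : ∀ᵐ x ∂volume.restrict U, Admissible p r ε R b f g h x)
    (hAB : StructureConditions U p r ε μ b f g h A B)
    (hu : MemSobolevLoc p U u Du)
    (hA : AEStronglyMeasurable (fun x => A x (u x) (Du x)) (volume.restrict U))
    (hB : AEStronglyMeasurable (fun x => B x (u x) (Du x)) (volume.restrict U))
    (hF : IntegrableOn (fun x => integrandJ p r ε c b f g h D x (u x) (Du x)) U)
    (heq : ∀ φ, IsTestFunction U φ →
      ∫ x in U, ⟪A x (u x) (Du x), gradient φ x⟫ = ∫ x in U, B x (u x) (Du x) * φ x) :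
    ∃ K : ℝ, 1 ≤ K ∧ IsQuasiminimizer p (integrandJ p r ε c b f g h D) K U u Du := by
  set F := integrandJ p r ε c b f g h D with hFdef
  have hp₀' : (1 : ℝ) ≤ p₀ := by exact_mod_cast hp₀
  have hp₀P' : (p₀ : ℝ) < P := by exact_mod_cast hp₀P
  have hP1 : 1 ≤ P := hp₀.trans hp₀P.le
  have hP0 : P ≠ 0 := by rintro rfl; simp at hP1
  have hP0' : (0 : ℝ) < P := by linarith
  have hF1 : ∀ x, Admissible p r ε R b f g h x → ∀ s ξ, 1 + ‖ξ‖ ^ p x ≤ F x s ξ := by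
    intro x H s ξ
    obtain ⟨k1, k2, k3⟩ := integrandJ_parts (D := D) hc H s ξ
    rw [hFdef]; unfold integrandJ; linarith
  have hF0 : ∀ x, Admissible p r ε R b f g h x → ∀ s ξ, 0 ≤ F x s ξ := fun x H s ξ =>
    le_trans (by positivity) (hF1 x H s ξ)
  have hFu0 : ∀ᵐ x ∂volume.restrict U, 0 ≤ F x (u x) (Du x) := by
    filter_upwards [hadm] with x H using hF0 x H _ _
  set J := ∫ x in U, F x (u x) (Du x) with hJ
  have hJ0 : 0 ≤ J := integral_nonneg_of_ae hFu0
  set G : ℝ := ((gnsConst n p₀ : ℝ≥0) : ℝ) with hG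
  set θ : ℝ := (P : ℝ) / p₀ with hθ
  have hθ1 : 1 < θ := by rw [hθ, one_lt_div (by linarith)]; exact hp₀P'
  -- Involves only the energy on all of $U$, hence serves every $\Omega'$ and every competitor; the
  -- small factor $1/(2(\Lambda+1))$ can therefore be chosen now.
  set Λ : ℝ := G ^ (P : ℝ) * ((2 ^ R * 2) ^ θ * J ^ (θ - 1)) with hΛ
  have hG0 : 0 ≤ G := NNReal.coe_nonneg _
  have hΛ0 : 0 ≤ Λ := by positivity
  obtain ⟨C, hC0, hC⟩ := exists_integrandJ_le (p := p) (r := r) (b := b) (f := f) (g := g) (h := h)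
    (D := D) hc hε hμ (by positivity : 0 < 1 / (2 * (Λ + 1))) hR hRP hκ
  refine ⟨max 1 (2 * C), le_max_left _ _, hu, fun S hS hSU' => ?_⟩
  have hSU : S ⊆ U := subset_closure.trans hSU'.2
  have hres : volume.restrict S ≤ volume.restrict U := Measure.restrict_mono hSU le_rfl
  have hac : volume.restrict S ≪ volume.restrict U := Measure.absolutelyContinuous_of_le hres
  have hSfin : volume S ≠ ⊤ := measure_ne_top_of_subset hSU hUfin
  have hFS : IntegrableOn (fun x => F x (u x) (Du x)) S := hF.mono_set hSU
  have hadmS := hac.ae_le hadm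
  have hFuS0 := hac.ae_le hFu0
  have hen : energy F S u Du = ENNReal.ofReal (∫ x in S, F x (u x) (Du x)) :=
    (ofReal_integral_eq_lintegral_ofReal hFS hFuS0).symm
  refine ⟨by rw [hen]; exact ENNReal.ofReal_lt_top, fun v Dv hv hw => ?_⟩
  have hK1 : (1 : ℝ≥0∞) ≤ ENNReal.ofReal (max 1 (2 * C)) := by
    rw [← ENNReal.ofReal_one]; exact ENNReal.ofReal_le_ofReal (le_max_left _ _)
  -- A competitor of larger or equal energy is trivial; in the other case its energy is finite and
  -- bounded by that of $u$.
  rcases le_or_gt (energy F S u Du) (energy F S v Dv) with hle | hlt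
  · exact hle.trans (le_mul_of_one_le_left (zero_le) hK1)
  have hvm : AEMeasurable v (volume.restrict S) :=
    (hv.1.1.aestronglyMeasurable.mono_measure hres).aemeasurable
  have hDvm : AEStronglyMeasurable Dv (volume.restrict S) :=
    hv.1.2.1.aestronglyMeasurable.mono_measure hres
  have hFvm : AEMeasurable (fun x => F x (v x) (Dv x)) (volume.restrict S) :=
    aemeasurable_integrandJ (hpm.mono_measure hres) (hrm.mono_measure hres)
      (hbm.mono_measure hres) (hfm.mono_measure hres) (hgm.mono_measure hres)
      (hhm.mono_measure hres) hvm hDvm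
  have hFv0 : ∀ᵐ x ∂volume.restrict S, 0 ≤ F x (v x) (Dv x) := by
    filter_upwards [hadmS] with x H using hF0 x H _ _
  have hFv : IntegrableOn (fun x => F x (v x) (Dv x)) S :=
    (lintegral_ofReal_ne_top_iff_integrable hFvm.aestronglyMeasurable hFv0).1 hlt.ne_top
  have hen' : energy F S v Dv = ENNReal.ofReal (∫ x in S, F x (v x) (Dv x)) :=
    (ofReal_integral_eq_lintegral_ofReal hFv hFv0).symm
  set Ju := ∫ x in S, F x (u x) (Du x) with hJu
  set Jv := ∫ x in S, F x (v x) (Dv x) with hJv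
  have hJu0 : 0 ≤ Ju := integral_nonneg_of_ae hFuS0
  have hJv0 : 0 ≤ Jv := integral_nonneg_of_ae hFv0
  have hJvu : Jv ≤ Ju := by
    rw [hen, hen'] at hlt
    by_contra hcon
    exact absurd hlt (not_lt.2 (ENNReal.ofReal_le_ofReal (not_le.1 hcon).le))
  have hJuJ : Ju ≤ J := setIntegral_mono_set hF hFu0 hSU.eventuallyLE
  have hpS : ∀ x ∈ S, p₀ ≤ p x := fun x hx => hp x (hSU hx)
  have hpRS : ∀ x ∈ S, p x ≤ R := fun x hx => hpR x (hSU hx)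
  obtain ⟨hXi, hwi, hwle⟩ := hw.integral_rpow_le hS.measurableSet hSfin hp₀ hn hP hP0
    (hpm.mono_measure hres) hpS hpRS
  have hABS : StructureConditions S p r ε μ b f g h A B := hac.ae_le hAB
  obtain ⟨hpi, hp0⟩ := hw.integral_pairing_eq_zero hS.measurableSet hSfin hp₀ hn hP hP1
    (hpm.mono_measure hres) hpS hpRS hFS (hA.mono_measure hres) (hB.mono_measure hres)
    (fun η hη => by
      obtain ⟨C', hC', hb'⟩ := exists_abs_pairing_le (p := p) (r := r) (b := b) (f := f) (g := g)
        (h := h) (D := D) hc hε hμ hη hRP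
      refine ⟨C', hC', ?_⟩
      filter_upwards [hadmS, hABS] with x H hx s ζ
      obtain ⟨-, h2, h3⟩ := hx (u x) (Du x)
      exact hb' x H (u x) s (Du x) ζ _ _ h2 h3)
    (fun φ hφ => by
      have h1 := heq φ (hφ.mono hSU)
      rwa [setIntegral_eq_of_subset_of_forall_sdiff_eq_zero hU.measurableSet hSU
          (fun x hx => by rw [hφ.gradient_eq_zero hx.2, inner_zero_right]),
        setIntegral_eq_of_subset_of_forall_sdiff_eq_zero hU.measurableSet hSU
          (fun x hx => by rw [hφ.eq_zero hx.2, mul_zero])] at h1)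
  -- The density dominates $1+|\xi|^p$, so the volume of $S$ is covered by the energy as well.
  have hIX : ∫ x in S, (1 + ‖Du x - Dv x‖ ^ p x) ≤ 2 ^ R * 2 * Ju := by
    have hfinS : IsFiniteMeasure (volume.restrict S) := ⟨by simpa using hSfin.lt_top⟩
    calc ∫ x in S, (1 + ‖Du x - Dv x‖ ^ p x)
        ≤ ∫ x in S, 2 ^ R * (F x (u x) (Du x) + F x (v x) (Dv x)) := by
          refine integral_mono_ae ((integrable_const 1).add hXi)
            ((hFS.add hFv).const_mul _) ?_
          filter_upwards [hadmS] with x H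
          have h1 := hF1 x H (u x) (Du x)
          have h2 := hF1 x H (v x) (Dv x)
          have h3 := add_rpow_le_two_rpow (R := R) (norm_nonneg (Du x - Dv x)) (norm_nonneg (Du x))
            (norm_nonneg (Dv x)) (norm_sub_le _ _) (by linarith [H.one_lt])
            (H.p_le_r.trans H.r_le)
          have h4 : (1 : ℝ) ≤ 2 ^ R := Real.one_le_rpow (by norm_num) hR.le
          have h5 := mul_le_mul_of_nonneg_left (add_le_add h1 h2) (by linarith : (0 : ℝ) ≤ 2 ^ R)
          linarith
      _ = 2 ^ R * (Ju + Jv) := by rw [integral_const_mul, integral_add hFS hFv]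
      _ ≤ 2 ^ R * (Ju + Ju) := by gcongr
      _ = _ := by ring
  have hW : ∫ x in S, ‖u x - v x‖ ^ (P : ℝ) ≤ Λ * Ju := by
    have hI0 : 0 ≤ ∫ x in S, (1 + ‖Du x - Dv x‖ ^ p x) := integral_nonneg fun x => by positivity
    calc ∫ x in S, ‖u x - v x‖ ^ (P : ℝ)
        ≤ (G * (∫ x in S, (1 + ‖Du x - Dv x‖ ^ p x)) ^ (1 / (p₀ : ℝ))) ^ (P : ℝ) := hwle
      _ ≤ (G * (2 ^ R * 2 * Ju) ^ (1 / (p₀ : ℝ))) ^ (P : ℝ) := by gcongr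
      _ = G ^ (P : ℝ) * ((2 ^ R * 2) ^ θ * Ju ^ θ) := by
          rw [Real.mul_rpow hG0 (by positivity), ← Real.rpow_mul (by positivity),
            Real.mul_rpow (by positivity) hJu0, hθ]
          congr 3 <;> ring
      -- The superlinear power becomes linear: one factor is kept and the rest is bounded by the
      -- total energy $J$.
      _ = G ^ (P : ℝ) * ((2 ^ R * 2) ^ θ * (Ju ^ (θ - 1) * Ju)) := by
          rw [← Real.rpow_add_one' hJu0 (by linarith), sub_add_cancel]
      _ ≤ G ^ (P : ℝ) * ((2 ^ R * 2) ^ θ * (J ^ (θ - 1) * Ju)) := by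
          have : 0 ≤ θ - 1 := by linarith
          gcongr
      _ = Λ * Ju := by rw [hΛ]; ring
  have hmain : Ju ≤ C * Jv + 1 / (2 * (Λ + 1)) * ∫ x in S, ‖u x - v x‖ ^ (P : ℝ) := by
    have i1 : IntegrableOn (fun x => 2 * (⟪A x (u x) (Du x), Du x - Dv x⟫ -
        B x (u x) (Du x) * (u x - v x)) + C * F x (v x) (Dv x)) S :=
      (hpi.const_mul 2).add (hFv.const_mul C)
    have hlim : Ju ≤ ∫ x in S, (2 * (⟪A x (u x) (Du x), Du x - Dv x⟫ -
        B x (u x) (Du x) * (u x - v x)) + C * F x (v x) (Dv x) +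
          1 / (2 * (Λ + 1)) * ‖u x - v x‖ ^ (P : ℝ)) := by
      refine integral_mono_ae hFS (i1.add (hwi.const_mul _)) ?_
      filter_upwards [hadmS, hABS] with x H hx
      obtain ⟨h1, h2, h3⟩ := hx (u x) (Du x)
      exact hC x H (u x) (v x) (Du x) (Dv x) _ _ h1 h2 h3
    rw [integral_add i1 (hwi.const_mul _),
      integral_add (hpi.const_mul 2) (hFv.const_mul C), integral_const_mul, integral_const_mul,
      integral_const_mul, hp0] at hlim
    linarith
  have hfinal : Ju ≤ 2 * C * Jv := by
    have h1 : 1 / (2 * (Λ + 1)) * ∫ x in S, ‖u x - v x‖ ^ (P : ℝ) ≤ 1 / 2 * Ju := by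
      calc 1 / (2 * (Λ + 1)) * ∫ x in S, ‖u x - v x‖ ^ (P : ℝ)
          ≤ 1 / (2 * (Λ + 1)) * (Λ * Ju) := by gcongr
        _ ≤ 1 / (2 * (Λ + 1)) * ((Λ + 1) * Ju) := by gcongr; linarith
        _ = 1 / 2 * Ju := by field_simp
    linarith
  rw [hen, hen', ← ENNReal.ofReal_mul (le_max_of_le_left zero_le_one)]
  refine ENNReal.ofReal_le_ofReal (hfinal.trans ?_)
  gcongr
  exact le_max_right _ _

end Quasiminimizer

end VarExp

end

/-! ### The main theorem: choice of the exponents and of the neighbourhood. -/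

theorem mainTheorem3 (n : ℕ) (Ω : Set (VarExp.E n)) (hΩ : IsOpen Ω)
    (hΩ_bdd : Bornology.IsBounded Ω)
    -- the exponents
    (p r σ : VarExp.E n → ℝ)
    (hp : ContinuousOn p Ω) (hp_lower : 1 < VarExp.lower p Ω) (hp_lt : ∀ x ∈ Ω, p x < n)
    (hr : ContinuousOn r Ω) (hr_bdd : BddAbove (r '' Ω)) (hpr : ∀ x ∈ Ω, p x ≤ r x)
    (hr_le : ∀ x ∈ Ω, r x ≤ VarExp.sobolevExp p x)
    (hσ : ContinuousOn σ Ω)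
    (hσ_gt : ∀ x ∈ Ω, r x < VarExp.sobolevExp p x →
      VarExp.sobolevExp p x / (VarExp.sobolevExp p x - r x) < σ x)
    (ε : ℝ) (hε : 0 < ε) (hε_lt : ε < VarExp.lower p Ω - 1)
    (t : ℝ) (ht : n / VarExp.lower p Ω < t)
    -- the coefficients and the structural conditions
    (μ : ℝ) (hμ : 1 ≤ μ) (b f g h : VarExp.E n → ℝ)
    (hb : ∀ᵐ x ∂volume.restrict Ω, 0 ≤ b x) (hf : ∀ᵐ x ∂volume.restrict Ω, 0 ≤ f x)
    (hg : ∀ᵐ x ∂volume.restrict Ω, 0 ≤ g x) (hh : ∀ᵐ x ∂volume.restrict Ω, 0 ≤ h x)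
    (hf_mem : MemLp f (ENNReal.ofReal t) (volume.restrict Ω))
    (hg_mem : VarExp.MemVarLp (fun x => t * VarExp.conjExp p x) Ω g)
    (hh_mem : VarExp.MemVarLp (fun x => t * VarExp.conjExp r x) Ω h)
    (A : VarExp.E n → ℝ → VarExp.E n → VarExp.E n) (B : VarExp.E n → ℝ → VarExp.E n → ℝ)
    (hAB : VarExp.StructureConditions Ω p r ε μ b f g h A B)
    -- the weak solution
    (u : VarExp.E n → ℝ) (Du : VarExp.E n → VarExp.E n)
    (hu : VarExp.IsWeakSolution p Ω A B u Du)
    -- the open set on which `r₊ < p*₋` and `b ∈ L^{s(·)}` (for instance `Ω` itself, or a small ball)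
    (D : Set (VarExp.E n)) (hD : IsOpen D) (hDΩ : D ⊆ Ω)
    (hD_gap : VarExp.upper r D < VarExp.lower (VarExp.sobolevExp p) D)
    (hb_mem : VarExp.MemVarLp (VarExp.coeffExp p r σ ε t D) D b)
    -- the constant in the definition of `𝔹`
    (c : ℝ) (hc : 0 < c) :
    VarExp.IsLocalQuasiminimizer p (VarExp.integrandJ p r ε c b f g h D) D u Du := by

  have ha1 : 1 < VarExp.lower p Ω := hp_lower
  have hpa : ∀ x ∈ Ω, VarExp.lower p Ω ≤ p x := fun x hx =>
    VarExp.lower_le_of_pos (by linarith) hx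
  set a := VarExp.lower p Ω with ha
  have hrR : ∀ x ∈ D, r x ≤ VarExp.upper r D := fun x hx =>
    le_csSup (hr_bdd.mono (image_mono hDΩ)) (mem_image_of_mem r hx)
  obtain ⟨RΩ, hRΩ⟩ := hr_bdd
  have hrRΩ : ∀ x ∈ Ω, r x ≤ RΩ := fun x hx => hRΩ (mem_image_of_mem r hx)
  have hΩm : MeasurableSet Ω := hΩ.measurableSet
  have hDm : MeasurableSet D := hD.measurableSet
  have hΩfin : volume Ω ≠ ⊤ := hΩ_bdd.measure_lt_top.ne
  have hDfin : volume D ≠ ⊤ := measure_ne_top_of_subset hDΩ hΩfin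
  refine ⟨hu.1.memSobolevLoc hΩm hDΩ, fun y hy => ?_⟩
  have hyΩ := hDΩ hy
  have hn0 : (0 : ℝ) < n := by linarith [hpa y hyΩ, hp_lt y hyΩ]
  have hn : 0 < n := by exact_mod_cast hn0
  -- Because $a\le p(y)<n$, the quotient $n/a$ exceeds $1$.
  have ht1 : 1 ≤ t := by
    have : (1 : ℝ) < n / a := by
      rw [one_lt_div (by linarith)]
      linarith [hpa y hyΩ, hp_lt y hyΩ]
    linarith
  have hR0 : 0 < VarExp.upper r D := by
    linarith [hrR y hy, hpr y hyΩ, hpa y hyΩ]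
  obtain ⟨p₀, hp₀1, hp₀P, hp₀p, hP⟩ := VarExp.exists_exponent (D := D) ha1
    (fun x hx => hpa x (hDΩ hx)) (fun x hx => hp_lt x (hDΩ hx)) ⟨y, hy⟩
  have hκ : VarExp.critExp p r D = VarExp.lower (VarExp.sobolevExp p) D /
    (VarExp.lower (VarExp.sobolevExp p) D - VarExp.upper r D) := rfl
  have hκ1 : 1 ≤ VarExp.critExp p r D := by
    rw [hκ, le_div_iff₀ (by linarith)]; linarith
  set R := VarExp.upper r D with hR
  generalize VarExp.lower (VarExp.sobolevExp p) D = P at hκ hP hp₀P hD_gap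
  lift p₀ to NNReal using by linarith
  lift P to NNReal using by linarith
  have hp₀1' : 1 ≤ p₀ := by exact_mod_cast hp₀1.le
  have hresD : volume.restrict D ≤ volume.restrict Ω := Measure.restrict_mono hDΩ le_rfl
  have hacD : volume.restrict D ≪ volume.restrict Ω := Measure.absolutelyContinuous_of_le hresD
  have hpmΩ : AEMeasurable p (volume.restrict Ω) := hp.aemeasurable hΩm
  have hpm : AEMeasurable p (volume.restrict D) := hpmΩ.mono_measure hresD
  have hrm : AEMeasurable r (volume.restrict D) := (hr.aemeasurable hΩm).mono_measure hresD
  have hz : IntegrableOn (VarExp.zCoeff p r ε c b f g h D) D :=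
    VarExp.integrableOn_zCoeff (a := a) hDm hDfin hε hc ht1 hκ1 (by linarith)
      (fun x hx => hpa x (hDΩ hx)) (fun x hx => hpr x (hDΩ hx)) hpm hrm (hacD.ae_le hb)
      (hacD.ae_le hg) (hacD.ae_le hh) (hf_mem.mono_measure hresD) (hg_mem.mono_set hDΩ)
      (hh_mem.mono_set hDΩ) hb_mem
  have hadmD : ∀ᵐ x ∂volume.restrict D, VarExp.Admissible p r ε R b f g h x := by
    filter_upwards [hacD.ae_le hb, hacD.ae_le hf, hacD.ae_le hg, hacD.ae_le hh,
      ae_restrict_mem hDm] with x h1 h2 h3 h4 hx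
    exact ⟨h1, h2, h3, h4, by linarith [hpa x (hDΩ hx)], hpr x (hDΩ hx), hrR x hx⟩
  obtain ⟨ρ', hρ', hball'⟩ := Metric.isOpen_iff.1 hD y hy
  -- The closed ball of radius $2\rho$, on which the cutoff in the local Sobolev embedding lives,
  -- must still lie in $D$.
  set ρ := ρ' / 3 with hρdef
  have hρ : 0 < ρ := by positivity
  have hKD : Metric.closedBall y (2 * ρ) ⊆ D :=
    (Metric.closedBall_subset_ball (by rw [hρdef]; linarith)).trans hball'
  have hUD : Metric.ball y ρ ⊆ D :=
    (Metric.ball_subset_closedBall.trans (Metric.closedBall_subset_closedBall (by linarith))).trans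
      hKD
  have hUΩ := hUD.trans hDΩ
  refine ⟨Metric.ball y ρ, Metric.isOpen_ball, Metric.mem_ball_self hρ, hUD, ?_⟩
  set U := Metric.ball y ρ with hU
  have hUm : MeasurableSet U := Metric.isOpen_ball.measurableSet
  have hUfin : volume U ≠ ⊤ := measure_ne_top_of_subset hUD hDfin
  have hKm : MeasurableSet (Metric.closedBall y (2 * ρ)) := Metric.isClosed_closedBall.measurableSet
  have hKfin : volume (Metric.closedBall y (2 * ρ)) ≠ ⊤ := measure_ne_top_of_subset hKD hDfin
  have hp₀0 : p₀ ≠ 0 := by rintro rfl; simp at hp₀1'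
  have hP0 : P ≠ 0 := by
    rintro rfl
    simp only [NNReal.coe_zero] at hp₀P
    linarith
  have huP := hu.1.1.memLp_ball hp₀1' hn hP hρ (hKD.trans hDΩ)
    ((hu.1.2.1.mono_set (hKD.trans hDΩ)).memLp hKm hKfin hp₀0 fun x hx => hp₀p x (hKD hx))
    ((hu.1.2.2.mono_set (hKD.trans hDΩ)).memLp hKm hKfin hp₀0 fun x hx => hp₀p x (hKD hx))
  have huPi : IntegrableOn (fun x => ‖u x‖ ^ (P : ℝ)) U := by
    have := huP.integrable_norm_rpow (by simpa using hP0) (by simp)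
    simpa [IntegrableOn] using this
  have hDui : IntegrableOn (fun x => ‖Du x‖ ^ p x) U :=
    (hu.1.2.2.integrableOn_rpow (e' := p) (M := RΩ) hΩm hΩfin hpmΩ
      (fun x hx => by linarith [hpa x hx]) (fun _ _ => le_rfl)
      (fun x hx => (hpr x hx).trans (hrRΩ x hx))).mono_set hUΩ
  have hresU : volume.restrict U ≤ volume.restrict D := Measure.restrict_mono hUD le_rfl
  have hresUΩ : volume.restrict U ≤ volume.restrict Ω := Measure.restrict_mono hUΩ le_rfl
  have hadmU := (Measure.absolutelyContinuous_of_le hresU).ae_le hadmD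
  have hpU := hpm.mono_measure hresU
  have hrU := hrm.mono_measure hresU
  have hbU : AEMeasurable b (volume.restrict U) := hb_mem.1.aemeasurable.mono_measure hresU
  have hfU : AEMeasurable f (volume.restrict U) := hf_mem.1.aemeasurable.mono_measure hresUΩ
  have hgU : AEMeasurable g (volume.restrict U) := hg_mem.1.aemeasurable.mono_measure hresUΩ
  have hhU : AEMeasurable h (volume.restrict U) := hh_mem.1.aemeasurable.mono_measure hresUΩ
  have hF : IntegrableOn (fun x => VarExp.integrandJ p r ε c b f g h D x (u x) (Du x)) U :=
    VarExp.integrableOn_integrandJ hc hR0 hD_gap hκ hadmU hε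
      (VarExp.aemeasurable_integrandJ hpU hrU hbU hfU hgU hhU
        (hu.1.2.1.1.aemeasurable.mono_measure hresUΩ) (hu.1.2.2.1.mono_measure hresUΩ))
      (hz.mono_set hUD) huPi hDui
  refine VarExp.exists_isQuasiminimizer Metric.isOpen_ball hUfin hc hε hμ hR0 hD_gap hκ hp₀1'
    (by exact_mod_cast hp₀P) hn hP hpU hrU hbU hfU hgU hhU (fun x hx => hp₀p x (hUD hx))
    (fun x hx => (hpr x (hUΩ hx)).trans (hrR x (hUD hx))) hadmU
    ((Measure.absolutelyContinuous_of_le hresUΩ).ae_le hAB) (hu.1.memSobolevLoc hΩm hUΩ)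
    (hu.2.1.aestronglyMeasurable.mono_measure hresUΩ)
    (hu.2.2.1.aestronglyMeasurable.mono_measure hresUΩ) hF fun φ hφ => ?_
  have h1 := hu.2.2.2 φ (hφ.mono hUΩ)
  rwa [setIntegral_eq_of_subset_of_forall_sdiff_eq_zero hΩm hUΩ
      (fun x hx => by rw [hφ.gradient_eq_zero hx.2, inner_zero_right]),
    setIntegral_eq_of_subset_of_forall_sdiff_eq_zero hΩm hUΩ
      (fun x hx => by rw [hφ.eq_zero hx.2, mul_zero])] at h1
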